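/- Let $S^2$ be the unit sphere in $\mathbb R^3$ with its round metric $h_{AB}$, area form $\epsilon_{AB}$, Levi-Civita derivative (written $D_A$ or $_{||A}$, so that $f_{||AB}=D_BD_Af$) and Laplacian $D^2$; indices are raised and lowered with $h$ and all integrals over $S^2$ are with respect to the standard area measure. Let $\chi_{AB}$ be a smooth symmetric traceless tensor field (the shear tensor), $N_A$ a smooth one-form (the angular aspect) and $m$ a smooth function (the mass aspect) on $S^2$, let $n$ be a linear combination of the $l=1$ spherical harmonics, and let $\alpha\in\mathbb R$. Define \begin{align*} J^{(\mathrm{CJK})} &= -\frac1{8\pi}\int_{S^2}\Bigl(3N_A+\tfrac14\chi_{AB}\chi^{BC}{}_{||C}\Bigr)\epsilon^{AD}n_{||D},\\ J^{(\mathrm{CN})} &= J^{(\mathrm{CJK})}-\frac{\alpha-1}{32\pi}\int_{S^2}\epsilon^{AD}n_{||D}\,\chi_{AB}\chi^{BC}{}_{||C},\\ J^{(\mathrm{CWY})} &= J^{(\mathrm{CJK})}+\frac1{4\pi}\int_{S^2}m\,\epsilon^{AB}n_{||B}\,\hat c_{||A}, \end{align*} where $\hat c$ is the smooth function without $l=0,1$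 parts that satisfies $D^2(D^2+2)\hat c=\chi_{AB}{}^{||BA}$. Then: 1. There are smooth functions $b,c:S^2\to\mathbb R$, both without $l=0,1$ parts, such that $$\chi_{AB}=2c_{||AB}-h_{AB}D^2c+\epsilon_{AC}\,b^{||C}{}_{||B}+\epsilon_{BC}\,b^{||C}{}_{||A}.\qquad(*)$$ 2. The function $\hat c$ exists and is unique. 3. Let $b,c$ be any smooth functions on $S^2$ that satisfy $(*)$. The parts of $\int_{S^2}\chi_{AB}\chi^{BC}{}_{||C}\,\epsilon^{AD}n_{||D}$ that are quadratic in $b$ alone and in $c$ alone (its values when $\chi$ is replaced by the right-hand side of $(*)$ with $c=0$, respectively with $b=0$) vanish, and \begin{align*} J^{(\mathrm{CJK})} &= \frac1{8\pi}\int_{S^2}\Bigl(-3N_A\epsilon^{AD}n_{||D}-2n_{||A}c^{||A}D^2b+\tfrac12 n\,D^2b\,D^2c-\tfrac12 n_{||A}\,D^2b\,(D^2c)^{||A}\Bigr),\\ J^{(\mathrm{CN})} &= \frac1{8\pi}\int_{S^2}\Bigl(-3N_A\epsilon^{AD}n_{||D}-2\alpha\, n_{||A}c^{||A}D^2b+\tfrac\alpha2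 n\,D^2b\,D^2c-\tfrac\alpha2 n_{||A}\,D^2b\,(D^2c)^{||A}\Bigr). \end{align*} If moreover $c$ has no $l=0,1$ parts, then $c=\hat c$ and $$J^{(\mathrm{CWY})} = \frac1{8\pi}\int_{S^2}\Bigl(-3N_A\epsilon^{AD}n_{||D}-2n_{||A}c^{||A}D^2b+\tfrac12 n\,D^2b\,D^2c-\tfrac12 n_{||A}\,D^2b\,(D^2c)^{||A}+2m\,\epsilon^{AD}n_{||D}c_{||A}\Bigr).$$ -/

import Mathlib

open MeasureTheory
open scoped Manifold ContDiff

noncomputable section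

namespace NullInfinity

/-! ### Tensor calculus on the round unit sphere

The sphere is the unit sphere of Euclidean `ℝ³`.  A covariant tensor at `p` on the tangent plane
`T_p = p^⊥` is identified with the tensor on `ℝ³` that vanishes as soon as one argument is normal,
and is given by its Cartesian components.  For such tangential tensors, raising an index with the
round metric does not change the components, and contraction with the round metric is the sum over
the Cartesian index. -/

/-- Euclidean three-space. -/
abbrev E3 : Type := EuclideanSpace ℝ (Fin 3)

/-- The unit sphere `S²`. -/
abbrev S2 : Type := Metric.sphere (0 : E3) 1

/-- The standard area measure of `S²` (total mass `4π`). -/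
def area : Measure S2 := (volume : Measure E3).toSphere

/-- Smooth real functions on `S²`. -/
def Smooth (f : S2 → ℝ) : Prop := ContMDiff (𝓡 2) 𝓘(ℝ, ℝ) ∞ f

/-- Extension of a function on `S²` to `ℝ³ ∖ {0}`, constant along rays. -/
def radialExt (f : S2 → ℝ) (x : E3) : ℝ :=
  if hx : x = 0 then 0 else f ⟨‖x‖⁻¹ • x, by
    rw [mem_sphere_zero_iff_norm, norm_smul, norm_inv, norm_norm,
      inv_mul_cancel₀ (norm_ne_zero_iff.mpr hx)]⟩

/-- The derivative of `f` at `p` in the direction of the tangential part of the `k`-th Cartesian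
unit vector.  (The radial extension has no radial derivative, so the projection is automatic.) -/
def tder (k : Fin 3) (f : S2 → ℝ) (p : S2) : ℝ :=
  fderiv ℝ (radialExt f) (p : E3) (EuclideanSpace.single k (1 : ℝ))

/-- The round metric `h_{AB}`, which is also the orthogonal projection onto the tangent plane. -/
def metric (p : S2) (i j : Fin 3) : ℝ :=
  (if i = j then 1 else 0) - (p : E3) i * (p : E3) j

/-- The area form `ε_{AB}`: `ε(X, Y) = det (p, X, Y)`, with the outward orientation. -/
def eps (p : S2) (i j : Fin 3) : ℝ :=
  Matrix.det (Matrix.of ![fun k => (p : E3) k, Pi.single i (1 : ℝ), Pi.single j (1 : ℝ)])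

/-- `f_{||A}`. -/
def grad (f : S2 → ℝ) (p : S2) (i : Fin 3) : ℝ := tder i f p

/-- `w_{A||B}`: Levi-Civita covariant derivative of a one-form, i.e. the tangential projection of
the tangential derivative.  The last index is the one of the derivative. -/
def covD1 (w : S2 → Fin 3 → ℝ) (p : S2) (i k : Fin 3) : ℝ :=
  ∑ a, metric p i a * tder k (fun q => w q a) p

/-- `T_{AB||C}`: Levi-Civita covariant derivative of a covariant tensor field of rank two.
The last index is the one of the derivative. -/
def covD2 (T : S2 → Fin 3 → Fin 3 → ℝ) (p : S2) (i j k : Fin 3) : ℝ :=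
  ∑ a, ∑ b, metric p i a * metric p j b * tder k (fun q => T q a b) p

/-- `f_{||AB}`. -/
def hess (f : S2 → ℝ) (p : S2) (i j : Fin 3) : ℝ := covD1 (grad f) p i j

/-- The Laplacian `D²f = f_{||A}^{||A}`. -/
def lap (f : S2 → ℝ) (p : S2) : ℝ := ∑ i, hess f p i i

/-- `w_A^{||A}`. -/
def div1 (w : S2 → Fin 3 → ℝ) (p : S2) : ℝ := ∑ i, covD1 w p i i

/-- `T_{AB}^{||B}`. -/
def div2 (T : S2 → Fin 3 → Fin 3 → ℝ) (p : S2) (i : Fin 3) : ℝ := ∑ j, covD2 T p i j j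

/-- `f_{||A} g^{||A}`. -/
def gradDot (f g : S2 → ℝ) (p : S2) : ℝ := ∑ i, grad f p i * grad g p i

/-- The vector field `ε^{AD} n_{||D}`. -/
def rot (n : S2 → ℝ) (p : S2) (i : Fin 3) : ℝ := ∑ d, eps p i d * grad n p d

/-- Smooth one-forms on `S²`. -/
structure IsOneForm (w : S2 → Fin 3 → ℝ) : Prop where
  smooth : ∀ i, Smooth fun p => w p i
  tangential : ∀ p, ∑ i, w p i * (p : E3) i = 0

/-- Smooth symmetric traceless covariant tensor fields of rank two on `S²`. -/
structure IsSymmTraceless (T : S2 → Fin 3 → Fin 3 → ℝ) : Prop where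
  smooth : ∀ i j, Smooth fun p => T p i j
  tangential : ∀ p i, ∑ j, T p i j * (p : E3) j = 0
  symm : ∀ p i j, T p i j = T p j i
  traceless : ∀ p, ∑ i, T p i i = 0

/-- Linear combinations of the `l = 1` spherical harmonics: restrictions of linear forms. -/
def IsDipole (n : S2 → ℝ) : Prop := ∃ a : E3, ∀ p : S2, n p = inner ℝ a (p : E3)

/-- `f` has no `l = 0` and no `l = 1` part: it is `L²`-orthogonal to the constants and to the
Cartesian coordinate functions, which span the `l = 1` spherical harmonics. -/
def NoLowModes (f : S2 → ℝ) : Prop :=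
  ∫ p, f p ∂area = 0 ∧ ∀ i : Fin 3, ∫ p, f p * (p : E3) i ∂area = 0

/-! ### Potentials and angular momenta -/

/-- `2 c_{||AB} - h_{AB} D²c + ε_{AC} b^{||C}_{||B} + ε_{BC} b^{||C}_{||A}`. -/
def shearOf (b c : S2 → ℝ) (p : S2) (i j : Fin 3) : ℝ :=
  2 * hess c p i j - metric p i j * lap c p
    + ∑ k, eps p i k * hess b p k j + ∑ k, eps p j k * hess b p k i

/-- `χ_{AB} χ^{BC}_{||C}`. -/
def quad (χ : S2 → Fin 3 → Fin 3 → ℝ) (p : S2) (i : Fin 3) : ℝ :=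
  ∑ j, χ p i j * div2 χ p j

/-- The Chruściel–Jezierski–Kijowski angular momentum. -/
def JCJK (N : S2 → Fin 3 → ℝ) (χ : S2 → Fin 3 → Fin 3 → ℝ) (n : S2 → ℝ) : ℝ :=
  -(1 / (8 * Real.pi)) *
    ∫ p, ∑ i, (3 * N p i + 1 / 4 * quad χ p i) * rot n p i ∂area

/-- The Compère–Nichols angular momentum with parameter `α`. -/
def JCN (α : ℝ) (N : S2 → Fin 3 → ℝ) (χ : S2 → Fin 3 → Fin 3 → ℝ) (n : S2 → ℝ) : ℝ :=
  JCJK N χ n - (α - 1) / (32 * Real.pi) * ∫ p, ∑ i, rot n p i * quad χ p i ∂area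

/-- `c` is a smooth solution of `D²(D² + 2)c = χ_{AB}^{||BA}` without `l = 0, 1` parts. -/
structure IsCWYPotential (χ : S2 → Fin 3 → Fin 3 → ℝ) (c : S2 → ℝ) : Prop where
  smooth : Smooth c
  noLow : NoLowModes c
  eqn : ∀ p, lap (fun q => lap c q + 2 * c q) p = div1 (div2 χ) p

/-- The solution of `D²(D² + 2)c = χ_{AB}^{||BA}` without `l = 0, 1` parts. -/
def cwyPotential (χ : S2 → Fin 3 → Fin 3 → ℝ) : S2 → ℝ :=
  Classical.epsilon (IsCWYPotential χ)

/-- The Chen–Wang–Yau angular momentum. -/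
def JCWY (m : S2 → ℝ) (N : S2 → Fin 3 → ℝ) (χ : S2 → Fin 3 → Fin 3 → ℝ) (n : S2 → ℝ) : ℝ :=
  JCJK N χ n
    + 1 / (4 * Real.pi) * ∫ p, m p * ∑ i, rot n p i * grad (cwyPotential χ) p i ∂area

end NullInfinity

end

/-!
The decomposition `(*)` holds because there are no harmonic one-forms and no transverse traceless
tensors on `S²`: a symmetric traceless tensor is determined by the divergence and the curl of its
divergence, which for the right-hand side of `(*)` are `D²(D² + 2)c` and `D²(D² + 2)b` up to sign.
So `b`, `c` and `ĉ` are found by solving `D²(D² + 2)u = g` for `g` without `l = 0, 1` parts.  Up to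
these low modes, `(1 - z) log (1 - z)` with `z = p · q` is a Green function of `D²(D² + 2)`: the
operator maps the regularization `(κ - z) log (κ - z)`, `κ > 1`, to a kernel that concentrates at
`z = 1` as `κ → 1`, plus a combination of `1` and `z`.  Uniqueness follows from the representation
formula, and existence by convolution.

The vector field `ε^{AD} n_{||D}` of a dipole `n` is Killing, so in the quadratic term of the
angular momentum the derivatives can be moved by parts onto the divergence of `χ`; what remains is
bilinear in `b` and `c`.
-/

noncomputable section

namespace NullInfinity

/-! ### Reflections and rotations of the sphere -/

section Reflection

open Metric

variable {E : Type*} [NormedAddCommGroup E] [InnerProductSpace ℝ E]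

/-- The reflection in the hyperplane orthogonal to `v`, which is the identity for `v = 0`. -/
def hyperplaneReflection (v : E) : E ≃ₗᵢ[ℝ] E := (ℝ ∙ v)ᗮ.reflection

lemma hyperplaneReflection_apply (v y : E) :
    hyperplaneReflection v y = y - (2 * inner ℝ v y / ‖v‖ ^ 2) • v := by
  rw [hyperplaneReflection, Submodule.reflection_orthogonal_apply,
    Submodule.reflection_singleton_apply, neg_sub, two_smul, ← add_smul]
  congr 2
  simp
  ring

lemma hyperplaneReflection_hyperplaneReflection (v y : E) :
    hyperplaneReflection v (hyperplaneReflection v y) = y :=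
  Submodule.reflection_reflection _ y

lemma inner_hyperplaneReflection_left (v x y : E) :
    inner ℝ (hyperplaneReflection v x) y = inner ℝ x (hyperplaneReflection v y) := by
  rw [← (hyperplaneReflection v).inner_map_map, hyperplaneReflection_hyperplaneReflection]

lemma hyperplaneReflection_add_of_norm_eq {x y : E} (h : ‖x‖ = ‖y‖) :
    hyperplaneReflection (x + y) x = -y := by
  simpa [hyperplaneReflection] using Submodule.reflection_sub (v := x) (w := -y) (by simpa using h)

lemma contDiffOn_hyperplaneReflection :
    ContDiffOn ℝ ∞ (fun z : E × E => hyperplaneReflection z.1 z.2) ({0}ᶜ ×ˢ Set.univ) := by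
  simp only [hyperplaneReflection_apply]
  intro z hz
  have hnorm : ‖z.1‖ ^ 2 ≠ 0 := pow_ne_zero 2 (norm_ne_zero_iff.2 hz.1)
  exact (contDiffAt_snd.sub (((contDiffAt_const.mul (contDiffAt_fst.inner ℝ contDiffAt_snd)).fun_div
    (contDiffAt_fst.norm_sq ℝ) hnorm).fun_smul contDiffAt_fst)).contDiffWithinAt

lemma hasDerivAt_hyperplaneReflection {v w : E} (hv : ‖v‖ = 1) (hvw : inner ℝ v w = 0) (y : E) :
    HasDerivAt (fun t : ℝ => hyperplaneReflection (v + t • w) y)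
      ((2 : ℝ) • (inner ℝ v (hyperplaneReflection v y) • w
        - inner ℝ w (hyperplaneReflection v y) • v)) 0 := by
  have hline : HasDerivAt (fun t : ℝ => v + t • w) w 0 := by
    simpa using ((hasDerivAt_id (0 : ℝ)).smul_const w).const_add v
  have hnum : HasDerivAt (fun t : ℝ => 2 * inner ℝ (v + t • w) y) (2 * inner ℝ w y) 0 := by
    simpa using (hline.inner ℝ (hasDerivAt_const 0 y)).const_mul 2
  have hden : HasDerivAt (fun t : ℝ => ‖v + t • w‖ ^ 2) 0 0 := by
    simpa [hvw] using hline.norm_sq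
  have hcoeff : HasDerivAt (fun t : ℝ => 2 * inner ℝ (v + t • w) y / ‖v + t • w‖ ^ 2)
      (2 * inner ℝ w y) 0 := by
    simpa [hv] using hnum.fun_div hden (by simp [hv])
  simp only [hyperplaneReflection_apply]
  refine ((hcoeff.fun_smul hline).const_sub y).congr_deriv ?_
  simp only [zero_smul, add_zero, hv, one_pow, div_one, inner_sub_right, inner_smul_right,
    real_inner_self_eq_norm_sq, real_inner_comm, hvw, mul_zero, sub_zero]
  module

/-- The homeomorphism of the unit sphere induced by a linear isometry of the ambient space. -/
def sphereMap (e : E ≃ₗᵢ[ℝ] E) : sphere (0 : E) 1 ≃ₜ sphere (0 : E) 1 :=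
  e.toHomeomorph.subtype fun x => by simp

@[simp]
lemma coe_sphereMap (e : E ≃ₗᵢ[ℝ] E) (p : sphere (0 : E) 1) : (sphereMap e p : E) = e p := rfl

variable [FiniteDimensional ℝ E] [MeasurableSpace E] [BorelSpace E]

open Pointwise in
lemma measurePreserving_sphereMap (e : E ≃ₗᵢ[ℝ] E) :
    MeasurePreserving (sphereMap e) (volume : Measure E).toSphere
      (volume : Measure E).toSphere := by
  refine ⟨(sphereMap e).continuous.measurable, ?_⟩
  ext s hs
  have hpre : MeasurableSet (sphereMap e ⁻¹' s) := (sphereMap e).continuous.measurable hs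
  have hcone : Set.Ioo (0 : ℝ) 1 • ((↑) '' (sphereMap e ⁻¹' s) : Set E)
      = e ⁻¹' (Set.Ioo (0 : ℝ) 1 • ((↑) '' s : Set E)) := by
    ext x
    simp only [Set.mem_smul, Set.mem_preimage, Set.mem_image]
    constructor
    · rintro ⟨r, hr, _, ⟨y, hy, rfl⟩, rfl⟩
      exact ⟨r, hr, _, ⟨_, hy, rfl⟩, by simp⟩
    · rintro ⟨r, hr, _, ⟨y, hy, rfl⟩, hx⟩
      exact ⟨r, hr, _, ⟨(sphereMap e).symm y, by simpa using hy, rfl⟩,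
        e.injective (by simpa [sphereMap] using hx)⟩
  rw [Measure.map_apply (sphereMap e).continuous.measurable hs, Measure.toSphere_apply' _ hpre,
    Measure.toSphere_apply' _ hs, hcone]
  congr 1
  exact e.measurePreserving.measure_preimage_equiv (f := e.toMeasurableEquiv) _

end Reflection

/-! ### Integrals depending smoothly on a parameter -/

section Parametric

lemma eventually_norm_le_of_continuousOn_prod {X Z Y V : Type*} [TopologicalSpace X]
    [TopologicalSpace Z] [TopologicalSpace Y] [CompactSpace Y] [SeminormedAddCommGroup V]
    {U : Set X} {W : Set Z} (hU : IsOpen U) (hW : IsOpen W) {Ψ : X × Z → V}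
    (hΨ : ContinuousOn Ψ (U ×ˢ W)) {j : Y → Z} (hj : Continuous j) (hjW : ∀ y, j y ∈ W) {v : X}
    (hv : v ∈ U) :
    ∃ M : ℝ, ∀ᶠ w in nhds v, w ∈ U ∧ ∀ y, ‖Ψ (w, j y)‖ ≤ M := by
  have hcpt : IsCompact (Set.range j) := isCompact_range hj
  have hsub : {v} ×ˢ Set.range j ⊆ U ×ˢ W :=
    Set.prod_mono (Set.singleton_subset_iff.2 hv) (Set.range_subset_iff.2 hjW)
  obtain ⟨M, hM⟩ := (isCompact_singleton.prod hcpt).exists_bound_of_continuousOn (hΨ.mono hsub)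
  have hopen : IsOpen (U ×ˢ W ∩ Ψ ⁻¹' Metric.ball 0 (M + 1)) :=
    hΨ.isOpen_inter_preimage (hU.prod hW) Metric.isOpen_ball
  obtain ⟨A, _, hA, -, hvA, hjB, hAB⟩ := generalized_tube_lemma isCompact_singleton hcpt hopen
    fun z hz => ⟨hsub hz, mem_ball_zero_iff.2 ((hM z hz).trans_lt (lt_add_one M))⟩
  refine ⟨M + 1, ?_⟩
  filter_upwards [hA.mem_nhds (hvA rfl), hU.mem_nhds hv] with w hwA hwU
  exact ⟨hwU, fun y => (mem_ball_zero_iff.1 (hAB ⟨hwA, hjB ⟨y, rfl⟩⟩).2).le⟩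

universe u

variable {E V : Type u} [NormedAddCommGroup E] [NormedSpace ℝ E] [NormedAddCommGroup V]
  {F Y : Type*} [NormedAddCommGroup F] [TopologicalSpace Y] [CompactSpace Y]
  [MeasurableSpace Y] [OpensMeasurableSpace Y] {μ : Measure Y}
  {U : Set E} {W : Set F} {j : Y → F} {g : Y → ℝ}

lemma integrable_of_continuous [IsFiniteMeasure μ] {f : Y → V} (hf : Continuous f) :
    Integrable f μ :=
  hf.integrable_of_hasCompactSupport (HasCompactSupport.of_compactSpace f)

variable [IsFiniteMeasure μ] [NormedSpace ℝ V] [NormedSpace ℝ F] {Φ : E × F → V}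

open ContinuousLinearMap in
lemma hasFDerivAt_integral_of_contDiffOn (hU : IsOpen U) (hW : IsOpen W)
    (hΦ : ContDiffOn ℝ 1 Φ (U ×ˢ W)) (hj : Continuous j) (hjW : ∀ y, j y ∈ W) (hg : Continuous g)
    {v : E} (hv : v ∈ U) :
    HasFDerivAt (fun v => ∫ y, g y • Φ (v, j y) ∂μ)
      (∫ y, g y • (fderiv ℝ Φ (v, j y)).comp (inl ℝ E F) ∂μ) v := by
  have hslice {V' : Type u} [NormedAddCommGroup V'] {Ψ : E × F → V'}
      (hΨ : ContinuousOn Ψ (U ×ˢ W)) {w : E} (hw : w ∈ U) : Continuous fun y => Ψ (w, j y) :=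
    hΨ.comp_continuous (by fun_prop) fun y => ⟨hw, hjW y⟩
  have hΦ' : ContinuousOn (fun z => (fderiv ℝ Φ z).comp (inl ℝ E F)) (U ×ˢ W) :=
    (hΦ.continuousOn_fderiv_of_isOpen (hU.prod hW) le_rfl).clm_comp continuousOn_const
  have hderiv {w : E} (hw : w ∈ U) (y : Y) :
      HasFDerivAt (fun w => Φ (w, j y)) ((fderiv ℝ Φ (w, j y)).comp (inl ℝ E F)) w :=
    (((hΦ.contDiffAt ((hU.prod hW).mem_nhds ⟨hw, hjW y⟩)).differentiableAt
      one_ne_zero).hasFDerivAt).comp w (hasFDerivAt_prodMk_left w (j y))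
  obtain ⟨M, hM⟩ := eventually_norm_le_of_continuousOn_prod hU hW hΦ' hj hjW hv
  refine hasFDerivAt_integral_of_dominated_of_fderiv_le hM
    (F' := fun w y => g y • (fderiv ℝ Φ (w, j y)).comp (inl ℝ E F))
    (bound := fun y => |g y| * M) ?_
    (integrable_of_continuous (hg.smul (hslice hΦ.continuousOn hv)))
    (integrable_of_continuous (hg.smul (hslice hΦ' hv))).1 ?_
    (integrable_of_continuous (hg.abs.mul_const M)) ?_
  · filter_upwards [hU.mem_nhds hv] with w hw
    exact (integrable_of_continuous (hg.smul (hslice hΦ.continuousOn hw))).1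
  · refine .of_forall fun y w hw => ?_
    rw [norm_smul, Real.norm_eq_abs]
    gcongr
    exact hw.2 y
  · exact .of_forall fun y w hw => (hderiv hw.1 y).const_smul (g y)

lemma contDiffOn_integral (hU : IsOpen U) (hW : IsOpen W) (hΦ : ContDiffOn ℝ ∞ Φ (U ×ˢ W))
    (hj : Continuous j) (hjW : ∀ y, j y ∈ W) (hg : Continuous g) :
    ContDiffOn ℝ ∞ (fun v => ∫ y, g y • Φ (v, j y) ∂μ) U := by
  refine contDiffOn_infty.2 fun n => ?_
  have hD {V' : Type u} [NormedAddCommGroup V'] [NormedSpace ℝ V'] {Ψ : E × F → V'}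
      (hΨ : ContDiffOn ℝ ∞ Ψ (U ×ˢ W)) {v : E} (hv : v ∈ U) :=
    hasFDerivAt_integral_of_contDiffOn (μ := μ) hU hW (hΨ.of_le (by simp)) hj hjW hg hv
  induction n generalizing V with
  | zero => exact contDiffOn_zero.2 fun v hv => (hD hΦ hv).continuousAt.continuousWithinAt
  | succ n ih =>
    push_cast
    rw [contDiffOn_succ_iff_fderiv_of_isOpen hU]
    refine ⟨fun v hv => (hD hΦ hv).differentiableAt.differentiableWithinAt, by simp, ?_⟩
    have hfderiv := ((contDiffOn_infty_iff_fderiv_of_isOpen (hU.prod hW)).1 hΦ).2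
    exact (ih (hfderiv.clm_comp contDiffOn_const)).congr fun v hv => (hD hΦ hv).fderiv

end Parametric

/-! ### Tangential derivatives -/

lemma coe_ne_zero (p : S2) : (p : E3) ≠ 0 := ne_zero_of_mem_unit_sphere p

/-- The radial projection of a nonzero vector to the sphere. -/
def radialProj (x : E3) (hx : x ≠ 0) : S2 :=
  ⟨‖x‖⁻¹ • x, by
    rw [mem_sphere_zero_iff_norm, norm_smul, norm_inv, norm_norm,
      inv_mul_cancel₀ (norm_ne_zero_iff.mpr hx)]⟩

lemma radialExt_of_ne (f : S2 → ℝ) {x : E3} (hx : x ≠ 0) : radialExt f x = f (radialProj x hx) :=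
  dif_neg hx

lemma radialExt_coe (f : S2 → ℝ) (p : S2) : radialExt f (p : E3) = f p := by
  rw [radialExt_of_ne f (coe_ne_zero p)]
  congr 1
  ext1
  simp [radialProj]

lemma radialExt_smul (f : S2 → ℝ) {r : ℝ} (hr : 0 < r) (x : E3) :
    radialExt f (r • x) = radialExt f x := by
  by_cases hx : x = 0
  · simp [hx]
  · rw [radialExt_of_ne f (smul_ne_zero hr.ne' hx), radialExt_of_ne f hx]
    congr 1
    ext1
    simp only [radialProj, norm_smul, Real.norm_of_nonneg hr.le, smul_smul]
    congr 1
    field_simp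

lemma hasFDerivAt_norm_inv_smul_self {E : Type*} [NormedAddCommGroup E] [InnerProductSpace ℝ E]
    {p : E} (hp : ‖p‖ = 1) :
    HasFDerivAt (fun x : E => ‖x‖⁻¹ • x)
      (ContinuousLinearMap.id ℝ E - (innerSL ℝ p).smulRight p) p := by
  have hnorm : HasFDerivAt (fun x : E => ‖x‖) (innerSL ℝ p) p := by
    have hsqrt := (hasStrictFDerivAt_norm_sq p).hasFDerivAt.sqrt (by simp [hp])
    simpa [hp, Real.sqrt_sq, ← Nat.cast_smul_eq_nsmul ℝ] using hsqrt
  have hinv : HasFDerivAt (fun x : E => ‖x‖⁻¹) (-innerSL ℝ p) p := by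
    simpa [hp, Function.comp_def] using
      (hasDerivAt_inv (x := ‖p‖) (by simp [hp])).comp_hasFDerivAt _ hnorm
  refine (hinv.fun_smul (hasFDerivAt_id p)).congr_fderiv ?_
  ext v
  simp [hp, sub_eq_add_neg]

lemma tder_eq_of_hasFDerivAt {f : S2 → ℝ} {F : E3 → ℝ} {F' : E3 →L[ℝ] ℝ} {p : S2}
    (hF : HasFDerivAt F F' (p : E3)) (hf : ∀ q : S2, f q = F q) (k : Fin 3) :
    tder k f p = F' (EuclideanSpace.single k 1 - (p : E3) k • (p : E3)) := by
  have hext : radialExt f =ᶠ[nhds (p : E3)] fun x => F (‖x‖⁻¹ • x) := by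
    filter_upwards [isOpen_compl_singleton.mem_nhds (coe_ne_zero p)] with x hx
    rw [radialExt_of_ne f hx, hf]
    rfl
  have hproj := hasFDerivAt_norm_inv_smul_self (norm_eq_of_mem_sphere p)
  have hcomp : HasFDerivAt (fun x => F (‖x‖⁻¹ • x)) _ (p : E3) :=
    HasFDerivAt.comp (g := F) (g' := F') (p : E3) (by simpa using hF) hproj
  rw [tder, hext.fderiv_eq, hcomp.fderiv]
  simp [EuclideanSpace.inner_single_right]

lemma contDiffOn_radialExt {f : S2 → ℝ} (hf : Smooth f) :
    ContDiffOn ℝ ∞ (radialExt f) {0}ᶜ := by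
  have : Fact (Module.finrank ℝ E3 = 2 + 1) := ⟨by simp⟩
  let U : TopologicalSpace.Opens E3 := ⟨{0}ᶜ, isOpen_compl_singleton⟩
  have hproj : ContMDiff 𝓘(ℝ, E3) 𝓘(ℝ, E3) ∞ fun x : U => ‖(x : E3)‖⁻¹ • (x : E3) := fun x =>
    (contMDiffAt_subtype_iff (f := fun y : E3 => ‖y‖⁻¹ • y)).2 <| ContDiffAt.contMDiffAt <|
      ((contDiffAt_norm ℝ x.2).inv (norm_ne_zero_iff.2 x.2)).smul contDiffAt_id
  have hcomp := ContMDiff.comp (g := f) hf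
    (hproj.codRestrict_sphere (n := 2) fun x => (radialProj x x.2).2)
  intro x hx
  refine (contMDiffAt_iff_contDiffAt.1 ?_).contDiffWithinAt
  refine (contMDiffAt_subtype_iff (U := U) (f := radialExt f) (x := ⟨x, hx⟩)).1 ?_
  exact (hcomp ⟨x, hx⟩).congr_of_eventuallyEq (.of_forall fun y => radialExt_of_ne f y.2)

lemma contDiffAt_radialExt {f : S2 → ℝ} (hf : Smooth f) {x : E3} (hx : x ≠ 0) :
    ContDiffAt ℝ ∞ (radialExt f) x :=
  (contDiffOn_radialExt hf).contDiffAt (isOpen_compl_singleton.mem_nhds hx)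

lemma hasFDerivAt_radialExt {f : S2 → ℝ} (hf : Smooth f) {x : E3} (hx : x ≠ 0) :
    HasFDerivAt (radialExt f) (fderiv ℝ (radialExt f) x) x :=
  ((contDiffAt_radialExt hf hx).differentiableAt (by simp)).hasFDerivAt

lemma smooth_of_contDiffAt {f : S2 → ℝ}
    (h : ∀ p : S2, ∃ F : E3 → ℝ, ContDiffAt ℝ ∞ F (p : E3) ∧ ∀ q : S2, f q = F q) : Smooth f := by
  have : Fact (Module.finrank ℝ E3 = 2 + 1) := ⟨by simp⟩
  intro p
  obtain ⟨F, hF, hfF⟩ := h p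
  rw [funext hfF]
  exact hF.contMDiffAt.comp p (contMDiff_coe_sphere (n := 2) p)

lemma Smooth.continuous {f : S2 → ℝ} (hf : Smooth f) : Continuous f := ContMDiff.continuous hf

lemma Smooth.tder {f : S2 → ℝ} (hf : Smooth f) (k : Fin 3) : Smooth (tder k f) :=
  smooth_of_contDiffAt fun p =>
    ⟨fun x => fderiv ℝ (radialExt f) x (EuclideanSpace.single k 1),
      ((contDiffAt_radialExt hf (coe_ne_zero p)).fderiv_right (by simp)).clm_apply contDiffAt_const,
      fun _ => rfl⟩

lemma smooth_coord (i : Fin 3) : Smooth fun p : S2 => (p : E3) i :=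
  smooth_of_contDiffAt fun _ => ⟨fun x => x i, by fun_prop, fun _ => rfl⟩

lemma fderiv_radialExt_self {f : S2 → ℝ} (hf : Smooth f) {x : E3} (hx : x ≠ 0) :
    fderiv ℝ (radialExt f) x x = 0 := by
  have hray : HasDerivAt (fun r : ℝ => r • x) x 1 := by
    simpa using (hasDerivAt_id (1 : ℝ)).smul_const x
  have hcomp : HasDerivAt (fun r : ℝ => radialExt f (r • x)) (fderiv ℝ (radialExt f) x x) 1 :=
    HasFDerivAt.comp_hasDerivAt (l := radialExt f) (l' := fderiv ℝ (radialExt f) x) (1 : ℝ)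
      (by simpa using hasFDerivAt_radialExt hf hx) hray
  have hconst : (fun r : ℝ => radialExt f (r • x)) =ᶠ[nhds 1] fun _ => radialExt f x := by
    filter_upwards [lt_mem_nhds one_pos] with r hr
    exact radialExt_smul f hr x
  exact (hcomp.congr_of_eventuallyEq hconst.symm).unique (hasDerivAt_const _ _)

lemma tder_const (k : Fin 3) (c : ℝ) (p : S2) : tder k (fun _ => c) p = 0 :=
  tder_eq_of_hasFDerivAt (hasFDerivAt_const c (p : E3)) (fun _ => rfl) k

lemma tder_add {f g : S2 → ℝ} (hf : Smooth f) (hg : Smooth g) (k : Fin 3) (p : S2) :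
    tder k (f + g) p = tder k f p + tder k g p := by
  have hp := coe_ne_zero p
  rw [tder_eq_of_hasFDerivAt ((hasFDerivAt_radialExt hf hp).add (hasFDerivAt_radialExt hg hp))
    (fun q => by simp [radialExt_coe])]
  simp [tder, fderiv_radialExt_self hf hp, fderiv_radialExt_self hg hp]

lemma tder_mul {f g : S2 → ℝ} (hf : Smooth f) (hg : Smooth g) (k : Fin 3) (p : S2) :
    tder k (f * g) p = f p * tder k g p + g p * tder k f p := by
  have hp := coe_ne_zero p
  rw [tder_eq_of_hasFDerivAt ((hasFDerivAt_radialExt hf hp).mul (hasFDerivAt_radialExt hg hp))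
    (fun q => by simp [radialExt_coe])]
  simp [tder, radialExt_coe, fderiv_radialExt_self hf hp, fderiv_radialExt_self hg hp]

lemma tder_comp {f : S2 → ℝ} (hf : Smooth f) {φ : ℝ → ℝ} {φ' : ℝ} {p : S2}
    (hφ : HasDerivAt φ φ' (f p)) (k : Fin 3) : tder k (fun q => φ (f q)) p = φ' * tder k f p := by
  have hp := coe_ne_zero p
  rw [← radialExt_coe f p] at hφ
  rw [tder_eq_of_hasFDerivAt (hφ.comp_hasFDerivAt _ (hasFDerivAt_radialExt hf hp))
    (fun q => by simp [radialExt_coe])]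
  simp [tder, fderiv_radialExt_self hf hp]

lemma tder_coord (i k : Fin 3) (p : S2) :
    tder k (fun q : S2 => (q : E3) i) p = (if i = k then 1 else 0) - (p : E3) i * (p : E3) k := by
  rw [tder_eq_of_hasFDerivAt (f := fun q : S2 => (q : E3) i)
    (EuclideanSpace.proj (𝕜 := ℝ) i).hasFDerivAt (fun _ => rfl)]
  simp [mul_comm]

lemma sum_coord_mul_self (p : S2) : ∑ i, (p : E3) i * (p : E3) i = 1 := by
  simpa [← sq, norm_eq_of_mem_sphere p] using (EuclideanSpace.real_norm_sq_eq (p : E3)).symm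

lemma sum_mul_fderiv_single (L : E3 →L[ℝ] ℝ) (v : E3) :
    ∑ i, v i * L (EuclideanSpace.single i 1) = L v := by
  conv_rhs => rw [← (EuclideanSpace.basisFun (Fin 3) ℝ).sum_repr v]
  simp

lemma sum_coord_mul_tder {f : S2 → ℝ} (hf : Smooth f) (p : S2) :
    ∑ i, (p : E3) i * tder i f p = 0 :=
  (sum_mul_fderiv_single _ _).trans (fderiv_radialExt_self hf (coe_ne_zero p))

lemma tder_comm {f : S2 → ℝ} (hf : Smooth f) (j k : Fin 3) (p : S2) :
    tder j (tder k f) p - tder k (tder j f) p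
      = (p : E3) j * tder k f p - (p : E3) k * tder j f p := by
  set D := fderiv ℝ (radialExt f)
  have hsmooth := contDiffAt_radialExt hf (coe_ne_zero p)
  have hD : HasFDerivAt D (fderiv ℝ D p) (p : E3) :=
    ((hsmooth.fderiv_right (m := 1) (by norm_cast)).differentiableAt one_ne_zero).hasFDerivAt
  have hsymm (v w : E3) : fderiv ℝ D p v w = fderiv ℝ D p w v :=
    hsmooth.isSymmSndFDerivAt (by simp; norm_cast) v w
  -- differentiate Euler's identity `D x x = 0`
  have heuler (v : E3) : fderiv ℝ D p v p = -D p v := by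
    have hzero : (fun x : E3 => D x x) =ᶠ[nhds (p : E3)] fun _ => 0 := by
      filter_upwards [isOpen_compl_singleton.mem_nhds (coe_ne_zero p)] with x hx
      exact fderiv_radialExt_self hf hx
    have := congrArg (fun L => L v) ((hD.clm_apply (hasFDerivAt_id _)).unique
      ((hasFDerivAt_const 0 (p : E3)).congr_of_eventuallyEq hzero))
    rw [eq_neg_iff_add_eq_zero, add_comm]
    simpa using this
  have htder (a b : Fin 3) : tder a (tder b f) p = (p : E3) a * tder b f p
      + fderiv ℝ D p (EuclideanSpace.single a 1) (EuclideanSpace.single b 1) := by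
    rw [tder_eq_of_hasFDerivAt (f := tder b f)
      (hD.clm_apply (hasFDerivAt_const (EuclideanSpace.single b 1) (p : E3))) (fun _ => rfl)]
    simp [hsymm p, heuler, tder, D]
    ring
  rw [htder, htder, hsymm]
  ring

/-! ### Integration over the sphere -/

instance : IsFiniteMeasure area := inferInstanceAs (IsFiniteMeasure (volume : Measure E3).toSphere)

instance : area.IsOpenPosMeasure :=
  inferInstanceAs (Measure.IsOpenPosMeasure (volume : Measure E3).toSphere)

lemma integral_sphereMap (e : E3 ≃ₗᵢ[ℝ] E3) (f : S2 → ℝ) :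
    ∫ p, f (sphereMap e p) ∂area = ∫ p, f p ∂area :=
  (measurePreserving_sphereMap e).integral_comp (sphereMap e).measurableEmbedding f

lemma contDiffOn_radialExt_hyperplaneReflection {f : S2 → ℝ} (hf : Smooth f) :
    ContDiffOn ℝ ∞ (fun z : E3 × E3 => radialExt f (hyperplaneReflection z.1 z.2))
      ({0}ᶜ ×ˢ {0}ᶜ) :=
  (contDiffOn_radialExt hf).comp
    (contDiffOn_hyperplaneReflection.mono (Set.prod_mono_right (Set.subset_univ _)))
    fun z hz => (map_ne_zero_iff _ (hyperplaneReflection z.1).injective).2 hz.2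

lemma radialExt_hyperplaneReflection (f : S2 → ℝ) (v : E3) (p : S2) :
    radialExt f (hyperplaneReflection v p) = f (sphereMap (hyperplaneReflection v) p) :=
  radialExt_coe f (sphereMap (hyperplaneReflection v) p)

lemma smooth_zonal_convolution {f : S2 → ℝ} (hf : Smooth f) {k : ℝ → ℝ} (hk : Continuous k) :
    Smooth fun x : S2 => ∫ y : S2, k (inner ℝ (x : E3) (y : E3)) * f y ∂area := by
  -- The reflection exchanging `x` and `-p` turns the kernel into one that does not depend on `x`,
  -- so that only `f` has to be differentiated.
  refine smooth_of_contDiffAt fun p => ⟨fun x => ∫ y : S2, k (-inner ℝ (p : E3) (y : E3)) •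
    radialExt f (hyperplaneReflection (x + p) y) ∂area, ?_, fun q => ?_⟩
  · have hsmooth := contDiffOn_integral (μ := area) isOpen_compl_singleton isOpen_compl_singleton
      (contDiffOn_radialExt_hyperplaneReflection hf) continuous_subtype_val coe_ne_zero
      (hk.comp (by fun_prop : Continuous fun y : S2 => -inner ℝ (p : E3) (y : E3)))
    have hp : (p : E3) + p ≠ 0 := by
      rw [← two_smul ℝ]
      exact smul_ne_zero two_ne_zero (coe_ne_zero p)
    exact (hsmooth.contDiffAt (isOpen_compl_singleton.mem_nhds hp)).comp
      (f := fun x : E3 => x + p) (p : E3) (by fun_prop)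
  · dsimp only
    rw [← integral_sphereMap (hyperplaneReflection (q + p))]
    refine integral_congr_ae (.of_forall fun y => ?_)
    simp only [radialExt_hyperplaneReflection, smul_eq_mul, coe_sphereMap,
      ← inner_hyperplaneReflection_left]
    rw [hyperplaneReflection_add_of_norm_eq (by simp), inner_neg_left]

lemma isOpen_compl_zero_prod : IsOpen (({0}ᶜ : Set E3) ×ˢ ({0}ᶜ : Set E3)) :=
  isOpen_compl_singleton.prod isOpen_compl_singleton

lemma fderiv_radialExt_hyperplaneReflection {f : S2 → ℝ} (hf : Smooth f) {v w : E3}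
    (hv : ‖v‖ = 1) (hvw : inner ℝ v w = 0) (y : S2) :
    fderiv ℝ (fun z : E3 × E3 => radialExt f (hyperplaneReflection z.1 z.2)) (v, y) (w, 0)
      = 2 * fderiv ℝ (radialExt f) (hyperplaneReflection v y)
          (inner ℝ v (hyperplaneReflection v y) • w
            - inner ℝ w (hyperplaneReflection v y) • v) := by
  set q := hyperplaneReflection v (y : E3)
  have hv0 : v ≠ 0 := norm_ne_zero_iff.1 (by simp [hv])
  have hq0 : q ≠ 0 := (map_ne_zero_iff _ (hyperplaneReflection v).injective).2 (coe_ne_zero y)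
  have hline : HasDerivAt (fun t : ℝ => (v + t • w, (y : E3))) (w, 0) 0 := by
    simpa using (((hasDerivAt_id (0 : ℝ)).smul_const w).const_add v).prodMk
      (hasDerivAt_const 0 (y : E3))
  have hΦ := ((contDiffOn_radialExt_hyperplaneReflection hf).contDiffAt
    (isOpen_compl_zero_prod.mem_nhds (Set.mk_mem_prod hv0 (coe_ne_zero y)))).differentiableAt
    (by simp)
  have hleft := HasFDerivAt.comp_hasDerivAt (0 : ℝ) (by simpa using hΦ.hasFDerivAt) hline
  have hright := HasFDerivAt.comp_hasDerivAt (l := radialExt f) (l' := fderiv ℝ (radialExt f) q)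
    (0 : ℝ) (by simpa using hasFDerivAt_radialExt hf hq0) (hasDerivAt_hyperplaneReflection hv hvw y)
  rw [hleft.unique hright, map_smul, smul_eq_mul]

lemma integral_rotation_of_orthogonal {f : S2 → ℝ} (hf : Smooth f) {v w : E3} (hv : ‖v‖ = 1)
    (hvw : inner ℝ v w = 0) :
    ∫ p : S2, fderiv ℝ (radialExt f) p
      (inner ℝ v (p : E3) • w - inner ℝ w (p : E3) • v) ∂area = 0 := by
  let Φ : E3 × E3 → ℝ := fun z => radialExt f (hyperplaneReflection z.1 z.2)
  have hv0 : v ≠ 0 := norm_ne_zero_iff.1 (by simp [hv])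
  have hΦ : ContDiffOn ℝ 1 Φ ({0}ᶜ ×ˢ {0}ᶜ) :=
    (contDiffOn_radialExt_hyperplaneReflection hf).of_le (by simp)
  have hconst : (fun u : E3 => ∫ y : S2, (1 : ℝ) • Φ (u, y) ∂area) = fun _ => ∫ y, f y ∂area := by
    funext u
    simp only [one_smul, Φ, radialExt_hyperplaneReflection]
    exact integral_sphereMap _ f
  have hderiv := hasFDerivAt_integral_of_contDiffOn (μ := area) isOpen_compl_singleton
    isOpen_compl_singleton hΦ continuous_subtype_val coe_ne_zero
    (continuous_const (y := (1 : ℝ))) (Set.mem_compl_singleton_iff.2 hv0)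
  have hcont : Continuous fun y : S2 =>
      (fderiv ℝ Φ (v, (y : E3))).comp (ContinuousLinearMap.inl ℝ E3 E3) :=
    ((hΦ.continuousOn_fderiv_of_isOpen isOpen_compl_zero_prod le_rfl).comp_continuous
      (by fun_prop) fun y => Set.mk_mem_prod hv0 (coe_ne_zero y)).clm_comp continuous_const
  have hzero : ∫ y : S2, fderiv ℝ Φ (v, (y : E3)) (w, 0) ∂area = 0 := by
    rw [hconst] at hderiv
    simp only [one_smul] at hderiv
    have := congrArg (fun L => L w) (hderiv.unique (hasFDerivAt_const _ _))
    simpa [ContinuousLinearMap.integral_apply (integrable_of_continuous hcont)] using this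
  simp only [Φ, fderiv_radialExt_hyperplaneReflection hf hv hvw, integral_const_mul] at hzero
  rw [← integral_sphereMap (hyperplaneReflection v)]
  simpa using hzero

lemma integral_coord_mul_tder_sub {f : S2 → ℝ} (hf : Smooth f) {j k : Fin 3} (hjk : j ≠ k) :
    ∫ p : S2, ((p : E3) j * tder k f p - (p : E3) k * tder j f p) ∂area = 0 := by
  simpa [EuclideanSpace.inner_single_left, tder] using integral_rotation_of_orthogonal hf
    (v := EuclideanSpace.single j 1) (w := EuclideanSpace.single k 1) (by simp)
    (by simp [EuclideanSpace.inner_single_left, hjk])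

/-! ### The algebra of tangential derivatives -/

/-- Coordinates `x i`, tangential derivatives `d i` and an integral on a commutative algebra,
subject to the relations that hold for smooth functions on the unit sphere of Euclidean
three-space.  All identities of tensor calculus on the sphere follow from these relations. -/
structure SphereCalculus (A : Type*) [CommRing A] [Algebra ℝ A] where
  /-- The tangential derivatives. -/
  d : Fin 3 → Derivation ℝ A A
  /-- The Cartesian coordinates. -/
  x : Fin 3 → A
  /-- The integral. -/
  integral : A →ₗ[ℝ] ℝ
  sum_x_mul_x : ∑ i, x i * x i = 1
  sum_x_mul_d : ∀ f, ∑ i, x i * d i f = 0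
  d_x : ∀ k i, d k (x i) = (if i = k then 1 else 0) - x i * x k
  d_d : ∀ j k f, d j (d k f) = d k (d j f) + x j * d k f - x k * d j f
  integral_d : ∀ k f, integral (d k f) = 2 * integral (x k * f)
  integral_mul_self_nonneg : ∀ f, 0 ≤ integral (f * f)
  eq_zero_of_integral_mul_self : ∀ f, integral (f * f) = 0 → f = 0

namespace SphereCalculus

open Matrix

variable {A : Type*} [CommRing A] [Algebra ℝ A] (S : SphereCalculus A)

/-- The gradient, as a tangential one-form. -/
def grad : A →ₗ[ℝ] Fin 3 → A := LinearMap.pi fun i => S.d i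

/-- The divergence of a tangential one-form. -/
def div : (Fin 3 → A) →ₗ[ℝ] A := ∑ i, S.d i ∘ₗ LinearMap.proj i

/-- The divergence of a symmetric traceless tensor. -/
def divT : (Fin 3 → Fin 3 → A) →ₗ[ℝ] Fin 3 → A := LinearMap.pi fun i => S.div ∘ₗ LinearMap.proj i

/-- The Laplacian. -/
def lap : A →ₗ[ℝ] A := S.div ∘ₗ S.grad

/-- The fourth-order operator `D²(D² + 2)`. -/
def bilap : A →ₗ[ℝ] A := S.lap ∘ₗ (S.lap + (2 : ℝ) • LinearMap.id)

/-- The scalar product of gradients. -/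
def gdot (f g : A) : A := S.grad f ⬝ᵥ S.grad g

/-- Rotation of a one-form by a right angle, `w_A ↦ ε_{AB} w^B`. -/
def star : (Fin 3 → A) →ₗ[A] Fin 3 → A := crossProduct.flip S.x

/-- Rotation of the second index of a tensor by a right angle.  For symmetric traceless tensors
this is the same as the rotation of the first index. -/
def starT (T : Fin 3 → Fin 3 → A) (i : Fin 3) : Fin 3 → A := S.star (T i)

/-- Twice the traceless Hessian, the gradient part of the shear tensor. -/
def shear (c : A) (i j : Fin 3) : A :=
  2 * (S.d j (S.d i c) + S.x i * S.d j c) - ((if i = j then 1 else 0) - S.x i * S.x j) * S.lap c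

/-- Tangential one-forms. -/
def Tang (w : Fin 3 → A) : Prop := w ⬝ᵥ S.x = 0

/-- Tangential symmetric traceless tensors. -/
structure IsSTT (T : Fin 3 → Fin 3 → A) : Prop where
  symm : ∀ i j, T i j = T j i
  tang : ∀ i, S.Tang (T i)
  trace : ∑ i, T i i = 0

variable {S} {w : Fin 3 → A} {T T' : Fin 3 → Fin 3 → A}

lemma IsSTT.add (hT : S.IsSTT T) (hT' : S.IsSTT T') : S.IsSTT (T + T') where
  symm i j := congrArg₂ (· + ·) (hT.symm i j) (hT'.symm i j)
  tang i := by
    rw [Tang, Pi.add_apply, add_dotProduct, hT.tang i, hT'.tang i, add_zero]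
  trace := by simp only [Pi.add_apply, Finset.sum_add_distrib, hT.trace, hT'.trace, add_zero]

lemma IsSTT.sub (hT : S.IsSTT T) (hT' : S.IsSTT T') : S.IsSTT (T - T') where
  symm i j := congrArg₂ (· - ·) (hT.symm i j) (hT'.symm i j)
  tang i := by
    rw [Tang, Pi.sub_apply, sub_dotProduct, hT.tang i, hT'.tang i, sub_zero]
  trace := by simp only [Pi.sub_apply, Finset.sum_sub_distrib, hT.trace, hT'.trace, sub_zero]

lemma Tang.eq (hw : S.Tang w) : w 0 * S.x 0 + w 1 * S.x 1 + w 2 * S.x 2 = 0 := by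
  simpa [Tang, dotProduct, Fin.sum_univ_three] using hw

variable (S)

lemma x_sq : S.x 0 * S.x 0 + S.x 1 * S.x 1 + S.x 2 * S.x 2 = 1 := by
  simpa [Fin.sum_univ_three] using S.sum_x_mul_x

lemma x_d (f : A) : S.x 0 * S.d 0 f + S.x 1 * S.d 1 f + S.x 2 * S.d 2 f = 0 := by
  simpa [Fin.sum_univ_three] using S.sum_x_mul_d f

lemma lap_eq (f : A) : S.lap f = S.d 0 (S.d 0 f) + S.d 1 (S.d 1 f) + S.d 2 (S.d 2 f) := by
  simp [lap, div, grad, Fin.sum_univ_three]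

lemma div_eq (w : Fin 3 → A) : S.div w = S.d 0 (w 0) + S.d 1 (w 1) + S.d 2 (w 2) := by
  simp [div, Fin.sum_univ_three]

lemma gdot_eq (f g : A) :
    S.gdot f g = S.d 0 f * S.d 0 g + S.d 1 f * S.d 1 g + S.d 2 f * S.d 2 g := by
  simp [gdot, grad, dotProduct, Fin.sum_univ_three]

lemma star_eq (w : Fin 3 → A) : S.star w = ![w 1 * S.x 2 - w 2 * S.x 1,
    w 2 * S.x 0 - w 0 * S.x 2, w 0 * S.x 1 - w 1 * S.x 0] :=
  cross_apply w S.x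

lemma d_two (k : Fin 3) : S.d k (2 : A) = 0 := mod_cast (S.d k).map_natCast 2

lemma lap_algebraMap (r : ℝ) : S.lap (algebraMap ℝ A r) = 0 := by simp [lap_eq]

lemma lap_algebraMap_mul (r : ℝ) (f : A) :
    S.lap (algebraMap ℝ A r * f) = algebraMap ℝ A r * S.lap f := by
  rw [← Algebra.smul_def, map_smul, Algebra.smul_def]

lemma lap_two_mul (f : A) : S.lap (2 * f) = 2 * S.lap f := by rw [two_mul, map_add, two_mul]

lemma bilap_eq (f : A) : S.bilap f = S.lap (S.lap f + 2 * f) := by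
  simp [bilap, two_smul, two_mul]

lemma lap_mul (f g : A) : S.lap (f * g) = f * S.lap g + g * S.lap f + 2 * S.gdot f g := by
  simp only [lap_eq, gdot_eq, Derivation.leibniz, smul_eq_mul, map_add]
  ring

lemma gdot_comm (f g : A) : S.gdot f g = S.gdot g f := dotProduct_comm _ _

lemma gdot_add_two_mul (f g h : A) : S.gdot f (g + 2 * h) = S.gdot f g + 2 * S.gdot f h := by
  simp only [gdot, two_mul, map_add, dotProduct_add]

lemma gdot_mul_left (f g h : A) : S.gdot (f * g) h = f * S.gdot g h + g * S.gdot f h := by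
  simp only [gdot_eq, Derivation.leibniz, smul_eq_mul]
  ring

lemma tang_grad (f : A) : S.Tang (S.grad f) := (dotProduct_comm _ _).trans (S.sum_x_mul_d f)

lemma tang_star (w : Fin 3 → A) : S.Tang (S.star w) :=
  (dotProduct_comm _ _).trans (dot_cross_self _ _)

variable {S}

lemma Tang.x_d (hw : S.Tang w) (j : Fin 3) :
    S.x 0 * S.d j (w 0) + S.x 1 * S.d j (w 1) + S.x 2 * S.d j (w 2) = -w j := by
  have hd := congrArg (S.d j) hw.eq
  have hδ : ∑ k, w k * (if k = j then 1 else 0) = w j := by simp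
  simp only [map_add, Derivation.leibniz, smul_eq_mul, S.d_x, map_zero] at hd
  rw [Fin.sum_univ_three] at hδ
  linear_combination hd + S.x j * hw.eq - hδ

variable (S)

lemma lap_d (f : A) (i : Fin 3) : S.lap (S.d i f) = S.d i (S.lap f) - 2 * S.x i * S.lap f := by
  have hddd (j : Fin 3) := congrArg (S.d j) (S.d_d j i f)
  have hxdd : S.x 0 * S.d i (S.d 0 f) + S.x 1 * S.d i (S.d 1 f) + S.x 2 * S.d i (S.d 2 f)
      = -S.d i f := (S.tang_grad f).x_d i
  have hδ : ∑ k, (if i = k then 1 else 0) * S.d k f = S.d i f := by simp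
  simp only [map_add, map_sub, Derivation.leibniz, smul_eq_mul, S.d_x, if_true] at hddd
  rw [Fin.sum_univ_three] at hδ
  simp only [lap_eq, hddd, S.d_d 0 i (S.d _ f), S.d_d 1 i (S.d _ f), S.d_d 2 i (S.d _ f), map_add]
  linear_combination S.x_d (S.d i f) + hxdd - S.d i f * S.x_sq + S.x i * S.x_d f
    - hδ

lemma lap_of_d_eq {f v w : A} (hf : ∀ k, S.d k f = v * S.d k w) :
    S.lap f = v * S.lap w + S.gdot v w := by
  simp only [lap_eq, hf, gdot_eq, Derivation.leibniz, smul_eq_mul]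
  ring

variable {S} in
lemma Tang.star_star (hw : S.Tang w) : S.star (S.star w) = -w := by
  change w ⨯₃ S.x ⨯₃ S.x = -w
  rw [cross_cross_eq_smul_sub_smul, show S.x ⬝ᵥ S.x = 1 from S.sum_x_mul_x,
    show w ⬝ᵥ S.x = 0 from hw, zero_smul, one_smul, zero_sub]

lemma star_dotProduct_comm (v w : Fin 3 → A) : S.star v ⬝ᵥ w = -(v ⬝ᵥ S.star w) := by
  simp only [star_eq, dotProduct, Fin.sum_univ_three, cons_val]
  ring

variable {S} in
lemma Tang.star_dotProduct_star (hw : S.Tang w) (v : Fin 3 → A) :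
    S.star v ⬝ᵥ S.star w = v ⬝ᵥ w := by
  rw [star_dotProduct_comm, hw.star_star, dotProduct_neg, neg_neg]

lemma div_star (w : Fin 3 → A) : S.div (S.star w)
    = S.x 0 * (S.d 1 (w 2) - S.d 2 (w 1)) + S.x 1 * (S.d 2 (w 0) - S.d 0 (w 2))
      + S.x 2 * (S.d 0 (w 1) - S.d 1 (w 0)) := by
  simp [star_eq, div_eq, S.d_x]
  ring

lemma div_star_grad (f : A) : S.div (S.star (S.grad f)) = 0 := by
  simp only [div_star, grad, LinearMap.pi_apply, Derivation.coeFn_coe, S.d_d 1 2 f, S.d_d 2 0 f,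
    S.d_d 0 1 f]
  ring

/-! ### Shear tensors and their divergences -/

lemma isSTT_shear (c : A) : S.IsSTT (S.shear c) where
  symm i j := by
    simp only [shear, S.d_d j i c, eq_comm (a := i) (b := j)]
    ring
  tang i := by
    have hδ : ∑ k, (if i = k then 1 else 0) * S.x k = S.x i := by simp
    rw [Fin.sum_univ_three] at hδ
    simp only [Tang, dotProduct, shear, Fin.sum_univ_three]
    linear_combination 2 * S.x_d (S.d i c) + 2 * S.x i * S.x_d c + S.x i * S.lap c * S.x_sq
      - S.lap c * hδ
  trace := by
    simp only [shear, Fin.sum_univ_three, if_true]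
    linear_combination -2 * S.lap_eq c + 2 * S.x_d c + S.lap c * S.x_sq

lemma divT_shear (c : A) : S.divT (S.shear c) = S.grad (S.lap c + 2 * c) := by
  funext i
  change S.div (S.shear c i) = S.d i (S.lap c + 2 * c)
  have hlap := S.lap_d c i
  have hδc : ∑ k, (if i = k then 1 else 0) * S.d k c = S.d i c := by simp
  have hδlap : ∑ k, (if i = k then 1 else 0) * S.d k (S.lap c) = S.d i (S.lap c) := by simp
  have hδd (k : Fin 3) : S.d k (if i = k then (1 : A) else 0) = 0 := by split_ifs <;> simp
  have hδx : ∑ k, (if i = k then 1 else 0) * S.x k = S.x i := by simp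
  rw [S.lap_eq (S.d i c)] at hlap
  rw [Fin.sum_univ_three] at hδc hδlap hδx
  simp only [div_eq, shear, map_sub, map_add, Derivation.leibniz, smul_eq_mul, S.d_x, d_two, hδd,
    if_true]
  linear_combination 2 * hlap - 2 * S.x i * S.lap_eq c - 2 * S.x i * S.x_d c
    + S.x i * S.x_d (S.lap c) - 2 * S.x i * S.lap c * S.x_sq + 2 * hδc - hδlap
    + S.lap c * hδx

variable {S}

lemma IsSTT.starT (hT : S.IsSTT T) : S.IsSTT (S.starT T) where
  symm := by
    have htr := hT.trace
    rw [Fin.sum_univ_three] at htr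
    -- The antisymmetric part of the rotated tensor is dual to `T x - (tr T) x = 0`.
    have h01 : T 0 2 * S.x 0 - T 0 0 * S.x 2 = T 1 1 * S.x 2 - T 1 2 * S.x 1 := by
      linear_combination (hT.tang 2).eq - S.x 2 * htr + S.x 0 * hT.symm 0 2 + S.x 1 * hT.symm 1 2
    have h02 : T 0 0 * S.x 1 - T 0 1 * S.x 0 = T 2 1 * S.x 2 - T 2 2 * S.x 1 := by
      linear_combination -(hT.tang 1).eq + S.x 1 * htr - S.x 0 * hT.symm 0 1 - S.x 2 * hT.symm 2 1
    have h12 : T 1 0 * S.x 1 - T 1 1 * S.x 0 = T 2 2 * S.x 0 - T 2 0 * S.x 2 := by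
      linear_combination (hT.tang 0).eq - S.x 0 * htr - S.x 1 * hT.symm 0 1 - S.x 2 * hT.symm 0 2
    simp [SphereCalculus.starT, star_eq, Fin.forall_fin_succ, h01, h02, h12]
  tang i := S.tang_star _
  trace := by
    simp only [SphereCalculus.starT, star_eq, Fin.sum_univ_three, cons_val]
    linear_combination S.x 2 * hT.symm 0 1 - S.x 1 * hT.symm 0 2 + S.x 0 * hT.symm 1 2

lemma IsSTT.divT_starT (hT : S.IsSTT T) : S.divT (S.starT T) = S.star (S.divT T) := by
  have hrow (i : Fin 3) : S.starT T i = fun j => S.star (T j) i :=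
    funext fun j => hT.starT.symm i j
  have h0 := (hT.tang 0).eq
  have h1 := (hT.tang 1).eq
  have h2 := (hT.tang 2).eq
  funext i
  change S.div (S.starT T i) = _
  rw [hrow i]
  fin_cases i
  all_goals
    simp only [star_eq, divT, div_eq, LinearMap.pi_apply, LinearMap.comp_apply,
      LinearMap.proj_apply, Fin.zero_eta, Fin.mk_one, Fin.reduceFinMk, cons_val]
    simp only [hT.symm 1 0, hT.symm 2 0, hT.symm 2 1, map_sub, Derivation.leibniz, S.d_x,
      smul_eq_mul, if_true, Fin.reduceEq, if_false] at h0 h1 h2 ⊢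
  · linear_combination S.x 1 * h2 - S.x 2 * h1
  · linear_combination S.x 2 * h0 - S.x 0 * h2
  · linear_combination S.x 0 * h1 - S.x 1 * h0

end SphereCalculus

/-! ### Integration by parts and rigidity -/

namespace SphereCalculus

open Matrix

variable {A : Type*} [CommRing A] [Algebra ℝ A] (S : SphereCalculus A)
  {w : Fin 3 → A} {T T' : Fin 3 → Fin 3 → A}

lemma integral_two_mul (f : A) : S.integral (2 * f) = 2 * S.integral f := by
  rw [two_mul, map_add, two_mul]

lemma div_smul (f : A) (w : Fin 3 → A) : S.div (f • w) = f * S.div w + S.grad f ⬝ᵥ w := by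
  simp only [div_eq, Pi.smul_apply, smul_eq_mul, Derivation.leibniz, grad, dotProduct,
    LinearMap.pi_apply, Derivation.coeFn_coe, Fin.sum_univ_three]
  ring

variable {S} in
lemma Tang.integral_div (hw : S.Tang w) : S.integral (S.div w) = 0 := by
  have hx : S.integral (S.x 0 * w 0 + S.x 1 * w 1 + S.x 2 * w 2) = 0 := by
    simpa only [mul_comm, map_zero] using congrArg S.integral hw.eq
  simp only [map_add] at hx
  simp only [div_eq, map_add, integral_d]
  linarith

variable {S} in
lemma Tang.integral_mul_div (hw : S.Tang w) (f : A) :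
    S.integral (f * S.div w) = -S.integral (S.grad f ⬝ᵥ w) := by
  have hfw : S.Tang (f • w) := by rw [Tang, smul_dotProduct, show w ⬝ᵥ S.x = 0 from hw, smul_zero]
  have h := hfw.integral_div
  rw [div_smul, map_add] at h
  exact eq_neg_of_add_eq_zero_left h

lemma integral_mul_lap (f g : A) : S.integral (f * S.lap g) = -S.integral (S.gdot f g) :=
  (S.tang_grad g).integral_mul_div f

lemma integral_mul_lap_comm (f g : A) :
    S.integral (f * S.lap g) = S.integral (g * S.lap f) := by
  rw [integral_mul_lap, integral_mul_lap, gdot_comm]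

lemma integral_mul_bilap_comm (f g : A) :
    S.integral (f * S.bilap g) = S.integral (g * S.bilap f) := by
  simp only [bilap_eq, map_add, lap_two_mul, mul_add, mul_left_comm _ (2 : A), integral_two_mul]
  rw [S.integral_mul_lap_comm f (S.lap g), S.integral_mul_lap_comm f g,
    S.integral_mul_lap_comm g (S.lap f), mul_comm (S.lap g)]

lemma d_eq_zero_of_lap_eq_zero {f : A} (hf : S.lap f = 0) (i : Fin 3) : S.d i f = 0 := by
  have h := S.integral_mul_lap f f
  rw [hf, mul_zero, map_zero, gdot, dotProduct, map_sum, zero_eq_neg,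
    Finset.sum_eq_zero_iff_of_nonneg fun i _ => S.integral_mul_self_nonneg _] at h
  exact S.eq_zero_of_integral_mul_self _ (h i (Finset.mem_univ i))

variable {S}

lemma Tang.d_comm_of_div_star_eq_zero (hw : S.Tang w) (hcurl : S.div (S.star w) = 0)
    (i j : Fin 3) : S.d i (w j) = S.d j (w i) + S.x i * w j - S.x j * w i := by
  rw [div_star] at hcurl
  have h12 : S.d 1 (w 2) = S.d 2 (w 1) + S.x 1 * w 2 - S.x 2 * w 1 := by
    linear_combination (-(S.d 1 (w 2) - S.d 2 (w 1))) * S.x_sq + S.x 0 * hcurl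
      + S.x 2 * (hw.x_d 1 - S.x_d (w 1)) - S.x 1 * (hw.x_d 2 - S.x_d (w 2))
  have h20 : S.d 2 (w 0) = S.d 0 (w 2) + S.x 2 * w 0 - S.x 0 * w 2 := by
    linear_combination (-(S.d 2 (w 0) - S.d 0 (w 2))) * S.x_sq + S.x 1 * hcurl
      + S.x 0 * (hw.x_d 2 - S.x_d (w 2)) - S.x 2 * (hw.x_d 0 - S.x_d (w 0))
  have h01 : S.d 0 (w 1) = S.d 1 (w 0) + S.x 0 * w 1 - S.x 1 * w 0 := by
    linear_combination (-(S.d 0 (w 1) - S.d 1 (w 0))) * S.x_sq + S.x 2 * hcurl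
      + S.x 1 * (hw.x_d 0 - S.x_d (w 0)) - S.x 0 * (hw.x_d 1 - S.x_d (w 1))
  fin_cases i <;> fin_cases j <;> grind

lemma Tang.lap_eq_zero_of_div_eq_zero (hw : S.Tang w) (hdiv : S.div w = 0)
    (hcurl : S.div (S.star w) = 0) (j : Fin 3) : S.lap (w j) = 0 := by
  have hcomm := hw.d_comm_of_div_star_eq_zero hcurl
  have hdd (i : Fin 3) := congrArg (S.d i) (hcomm i j)
  have hddiv := congrArg (S.d j) hdiv
  have hδ : ∑ k, (if j = k then 1 else 0) * w k = w j := by simp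
  simp only [div_eq, map_add, map_zero] at hddiv hdiv
  rw [Fin.sum_univ_three] at hδ
  simp only [map_add, map_sub, Derivation.leibniz, smul_eq_mul, S.d_x, if_true] at hdd
  simp only [lap_eq, hdd, S.d_d 0 j (w _), S.d_d 1 j (w _), S.d_d 2 j (w _)]
  linear_combination hddiv + hw.x_d j + S.x_d (w j) - 2 * S.x j * hdiv - w j * S.x_sq
    + S.x j * hw.eq - hδ

lemma Tang.eq_zero_of_div_eq_zero (hw : S.Tang w) (hdiv : S.div w = 0)
    (hcurl : S.div (S.star w) = 0) : w = 0 := by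
  funext j
  have hd (i : Fin 3) : S.d j (w i) = 0 :=
    S.d_eq_zero_of_lap_eq_zero (hw.lap_eq_zero_of_div_eq_zero hdiv hcurl i) j
  simpa [hd] using hw.x_d j

lemma IsSTT.tang_divT (hT : S.IsSTT T) : S.Tang (S.divT T) := by
  have h0 := (hT.tang 0).x_d 0
  have h1 := (hT.tang 1).x_d 1
  have h2 := (hT.tang 2).x_d 2
  have htr := hT.trace
  rw [Fin.sum_univ_three] at htr
  simp only [Tang, dotProduct, divT, LinearMap.pi_apply, LinearMap.comp_apply,
    LinearMap.proj_apply, div_eq, Fin.sum_univ_three]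
  rw [hT.symm 0 1, hT.symm 0 2, hT.symm 1 2] at *
  linear_combination h0 + h1 + h2 - htr

lemma IsSTT.eq_zero_of_divT_eq_zero (hT : S.IsSTT T) (hdiv : S.divT T = 0) : T = 0 := by
  funext i
  refine (hT.tang i).eq_zero_of_div_eq_zero (congrFun hdiv i) ?_
  change S.divT (S.starT T) i = 0
  rw [hT.divT_starT, hdiv, map_zero, Pi.zero_apply]

lemma IsSTT.eq_of_div_divT_eq (hT : S.IsSTT T) (hT' : S.IsSTT T')
    (hdiv : S.div (S.divT T) = S.div (S.divT T'))
    (hcurl : S.div (S.star (S.divT T)) = S.div (S.star (S.divT T'))) : T = T' := by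
  have hsub := hT.sub hT'
  refine sub_eq_zero.1 <| hsub.eq_zero_of_divT_eq_zero <|
    hsub.tang_divT.eq_zero_of_div_eq_zero ?_ ?_
  · rw [map_sub, map_sub, hdiv, sub_self]
  · rw [map_sub, map_sub, map_sub, hcurl, sub_self]

lemma IsSTT.integral_div_divT_mul_x (hT : S.IsSTT T) (k : Fin 3) :
    S.integral (S.div (S.divT T) * S.x k) = 0 := by
  have hgrad : S.grad (S.x k) ⬝ᵥ S.divT T = S.div (T k) := by
    have hδ : ∑ i, (if k = i then 1 else 0) * S.divT T i = S.div (T k) := by simp [divT]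
    rw [Fin.sum_univ_three] at hδ
    simp only [grad, dotProduct, LinearMap.pi_apply, Derivation.coeFn_coe, S.d_x,
      Fin.sum_univ_three]
    linear_combination hδ - S.x k * hT.tang_divT.eq
  rw [mul_comm, hT.tang_divT.integral_mul_div, hgrad, (hT.tang k).integral_div, neg_zero]

variable (S)

lemma integral_x (k : Fin 3) : S.integral (S.x k) = 0 := by
  have h := S.integral_d k 1
  rw [Derivation.map_one_eq_zero, map_zero, mul_one] at h
  linarith

lemma integral_x_mul_x (i k : Fin 3) :
    3 * S.integral (S.x i * S.x k) = if i = k then S.integral 1 else 0 := by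
  have h := S.integral_d k (S.x i)
  rw [S.d_x, map_sub, mul_comm (S.x k)] at h
  split_ifs at h ⊢
  · linarith
  · rw [map_zero] at h
    linarith

end SphereCalculus

/-! ### Linear functions and rotation fields -/

namespace SphereCalculus

open Matrix

variable {A : Type*} [CommRing A] [Algebra ℝ A] (S : SphereCalculus A)
  {T : Fin 3 → Fin 3 → A}

/-- The restriction to the sphere of the linear form with coefficients `a`. -/
def lin (a : Fin 3 → ℝ) : A := ∑ i, algebraMap ℝ A (a i) * S.x i

/-- The vector field `ε^{AD} n_{||D}`. -/
def rot (n : A) : Fin 3 → A := S.star (S.grad n)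

lemma lin_eq (a : Fin 3 → ℝ) : S.lin a = algebraMap ℝ A (a 0) * S.x 0
    + algebraMap ℝ A (a 1) * S.x 1 + algebraMap ℝ A (a 2) * S.x 2 :=
  Fin.sum_univ_three _

lemma d_lin (a : Fin 3 → ℝ) (k : Fin 3) :
    S.d k (S.lin a) = algebraMap ℝ A (a k) - S.lin a * S.x k := by
  have hδ : ∑ i, algebraMap ℝ A (a i) * (if i = k then 1 else 0) = algebraMap ℝ A (a k) := by simp
  rw [Fin.sum_univ_three] at hδ
  simp only [lin_eq, map_add, Derivation.leibniz, smul_eq_mul, S.d_x, Derivation.map_algebraMap]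
  linear_combination hδ

lemma lap_lin (a : Fin 3 → ℝ) : S.lap (S.lin a) = -2 * S.lin a := by
  have hxd := S.x_d (S.lin a)
  simp only [lap_eq, d_lin, map_sub, Derivation.map_algebraMap, Derivation.leibniz, smul_eq_mul,
    S.d_x, if_true] at hxd ⊢
  linear_combination -hxd + S.lin a * S.x_sq

lemma bilap_lin (a : Fin 3 → ℝ) : S.bilap (S.lin a) = 0 := by
  rw [bilap_eq, lap_lin, neg_mul, neg_add_cancel, map_zero]

lemma gdot_lin (a : Fin 3 → ℝ) (f : A) :
    S.gdot (S.lin a) f = ∑ i, algebraMap ℝ A (a i) * S.d i f := by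
  simp only [gdot_eq, Fin.sum_univ_three, d_lin]
  linear_combination -S.lin a * S.x_d f

lemma gdot_lin_self {a : Fin 3 → ℝ} (ha : ∑ i, a i ^ 2 = 1) :
    S.gdot (S.lin a) (S.lin a) = 1 - S.lin a * S.lin a := by
  have ha' : algebraMap ℝ A (a 0) ^ 2 + algebraMap ℝ A (a 1) ^ 2 + algebraMap ℝ A (a 2) ^ 2
      = 1 := by
    simpa [Fin.sum_univ_three] using congrArg (algebraMap ℝ A) ha
  simp only [gdot_lin, Fin.sum_univ_three, d_lin]
  linear_combination ha' + S.lin a * S.lin_eq a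

lemma lap_gdot_lin (a : Fin 3 → ℝ) (f : A) :
    S.lap (S.gdot (S.lin a) f) = S.gdot (S.lin a) (S.lap f) - 2 * S.lin a * S.lap f := by
  simp only [gdot_lin, Fin.sum_univ_three, map_add, lap_algebraMap_mul, lap_d]
  linear_combination 2 * S.lap f * S.lin_eq a

lemma lap_lin_mul_add_gdot (a : Fin 3 → ℝ) (f : A) :
    S.lap (S.lin a * f + S.gdot (S.lin a) f)
      = S.gdot (S.lin a) (S.lap f + 2 * f) - S.lin a * (S.lap f + 2 * f) := by
  rw [map_add, lap_mul, lap_gdot_lin, lap_lin, gdot_add_two_mul]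
  ring

lemma rot_lin (a : Fin 3 → ℝ) : S.rot (S.lin a) = (fun i => algebraMap ℝ A (a i)) ⨯₃ S.x := by
  have hgrad : S.grad (S.lin a) = (fun i => algebraMap ℝ A (a i)) - S.lin a • S.x :=
    funext fun k => S.d_lin a k
  rw [rot, hgrad, map_sub, map_smul, show S.star S.x = 0 from cross_self S.x, smul_zero, sub_zero]
  rfl

lemma div_rot (n : A) : S.div (S.rot n) = 0 := S.div_star_grad n

lemma tang_rot (n : A) : S.Tang (S.rot n) := S.tang_star _

variable {S}

lemma IsSTT.sum_dotProduct_grad_rot_lin (hT : S.IsSTT T) (a : Fin 3 → ℝ) :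
    ∑ i, T i ⬝ᵥ S.grad (S.rot (S.lin a) i) = 0 := by
  simp only [rot_lin, cross_apply, grad, dotProduct, LinearMap.pi_apply, Derivation.coeFn_coe,
    Fin.sum_univ_three, cons_val, map_sub, Derivation.leibniz, Derivation.map_algebraMap,
    smul_eq_mul, S.d_x, if_true, Fin.reduceEq, if_false]
  linear_combination algebraMap ℝ A (a 0) * hT.symm 2 1 + algebraMap ℝ A (a 1) * hT.symm 0 2
    + algebraMap ℝ A (a 2) * hT.symm 1 0
    - (algebraMap ℝ A (a 1) * S.x 2 - algebraMap ℝ A (a 2) * S.x 1) * (hT.tang 0).eq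
    - (algebraMap ℝ A (a 2) * S.x 0 - algebraMap ℝ A (a 0) * S.x 2) * (hT.tang 1).eq
    - (algebraMap ℝ A (a 0) * S.x 1 - algebraMap ℝ A (a 1) * S.x 0) * (hT.tang 2).eq

/-- The rotation field is Killing, so only `f` and the divergence of `T` contribute. -/
lemma IsSTT.integral_dotProduct_grad_dotProduct_rot_lin (hT : S.IsSTT T) (a : Fin 3 → ℝ) (f : A) :
    S.integral ((fun i => T i ⬝ᵥ S.grad f) ⬝ᵥ S.rot (S.lin a))
      = -S.integral (f * (S.divT T ⬝ᵥ S.rot (S.lin a))) := by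
  set ξ := S.rot (S.lin a)
  have hw : S.Tang fun i => T i ⬝ᵥ ξ := by
    simp only [Tang, dotProduct, Fin.sum_univ_three, hT.symm 0 1, hT.symm 0 2, hT.symm 1 2]
    have h0 := (hT.tang 0).eq
    have h1 := (hT.tang 1).eq
    rw [hT.symm 0 1, hT.symm 0 2] at h0
    rw [hT.symm 1 2] at h1
    linear_combination ξ 0 * h0 + ξ 1 * h1 + ξ 2 * (hT.tang 2).eq
  have hdiv : S.div (fun i => T i ⬝ᵥ ξ) = S.divT T ⬝ᵥ ξ := by
    have hk := hT.sum_dotProduct_grad_rot_lin a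
    simp only [dotProduct, grad, LinearMap.pi_apply, Derivation.coeFn_coe, Fin.sum_univ_three,
      div_eq, divT, LinearMap.comp_apply, LinearMap.proj_apply, map_add, Derivation.leibniz,
      smul_eq_mul] at hk ⊢
    rw [hT.symm 0 1, hT.symm 0 2, hT.symm 1 2] at *
    linear_combination hk
  have hswap : (fun i => T i ⬝ᵥ S.grad f) ⬝ᵥ ξ = S.grad f ⬝ᵥ fun i => T i ⬝ᵥ ξ := by
    simp only [dotProduct, Fin.sum_univ_three, hT.symm 1 0, hT.symm 2 0, hT.symm 2 1]
    ring
  rw [hswap, ← hdiv, hw.integral_mul_div, neg_neg]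

variable (S)

lemma integral_mul_grad_dotProduct_rot (n f : A) :
    S.integral (f * (S.grad f ⬝ᵥ S.rot n)) = 0 := by
  have h := (S.tang_rot n).integral_mul_div (f * f)
  have hsq : S.grad (f * f) ⬝ᵥ S.rot n = 2 * (f * (S.grad f ⬝ᵥ S.rot n)) := by
    simp only [grad, dotProduct, LinearMap.pi_apply, Derivation.coeFn_coe, Derivation.leibniz,
      smul_eq_mul, Fin.sum_univ_three]
    ring
  rw [div_rot, mul_zero, map_zero, hsq, integral_two_mul] at h
  linarith

lemma integral_mul_gdot_lin_add (a : Fin 3 → ℝ) (f g : A) :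
    S.integral (f * S.gdot (S.lin a) g) + S.integral (g * S.gdot (S.lin a) f)
      = 2 * S.integral (S.lin a * (f * g)) := by
  have h := S.integral_mul_lap (f * g) (S.lin a)
  rw [lap_lin, gdot_mul_left, S.gdot_comm g, S.gdot_comm f, map_add,
    show f * g * (-2 * S.lin a) = -(2 * (S.lin a * (f * g))) by ring, map_neg,
    integral_two_mul] at h
  linarith

/-! ### The quadratic term of the angular momentum -/

/-- The shear tensor with potentials `b` and `c`. -/
def shearPair (b c : A) : Fin 3 → Fin 3 → A := S.shear c + S.starT (S.shear b)

/-- `χ_{AB} χ^{BC}_{||C}` contracted with the rotation field of `n`. -/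
def quadRot (T : Fin 3 → Fin 3 → A) (n : A) : A := (fun i => T i ⬝ᵥ S.divT T) ⬝ᵥ S.rot n

lemma isSTT_shearPair (b c : A) : S.IsSTT (S.shearPair b c) :=
  (S.isSTT_shear c).add (S.isSTT_shear b).starT

lemma divT_shearPair (b c : A) : S.divT (S.shearPair b c)
    = S.grad (S.lap c + 2 * c) + S.star (S.grad (S.lap b + 2 * b)) := by
  rw [shearPair, map_add, divT_shear, (S.isSTT_shear b).divT_starT, divT_shear]

lemma div_divT_shearPair (b c : A) : S.div (S.divT (S.shearPair b c)) = S.bilap c := by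
  rw [divT_shearPair, map_add, div_star_grad, add_zero, bilap_eq]
  rfl

lemma div_star_divT_shearPair (b c : A) :
    S.div (S.star (S.divT (S.shearPair b c))) = -S.bilap b := by
  rw [divT_shearPair, map_add, map_add, div_star_grad, (S.tang_grad _).star_star, zero_add,
    map_neg, bilap_eq]
  rfl

variable {S} in
lemma IsSTT.integral_quadRot_of_divT_eq (hT : S.IsSTT T) {B C : A}
    (hdiv : S.divT T = S.grad C + S.star (S.grad B)) (a : Fin 3 → ℝ) :
    S.integral (S.quadRot T (S.lin a))
      = S.integral (B * S.gdot (S.lin a) C) - S.integral (C * S.gdot (S.lin a) B) := by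
  set n := S.lin a
  have hquad : S.quadRot T n = (fun i => T i ⬝ᵥ S.grad C) ⬝ᵥ S.rot n
      - (fun i => S.starT T i ⬝ᵥ S.grad B) ⬝ᵥ S.rot n := by
    rw [quadRot, hdiv, ← sub_dotProduct]
    congr 1
    funext i
    rw [dotProduct_add, Pi.sub_apply, SphereCalculus.starT, star_dotProduct_comm, sub_neg_eq_add]
  have hrot : S.divT T ⬝ᵥ S.rot n = S.grad C ⬝ᵥ S.rot n + S.gdot n B := by
    rw [hdiv, add_dotProduct, rot, (S.tang_grad n).star_dotProduct_star, S.gdot_comm, gdot]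
  have hrot_star : S.divT (S.starT T) ⬝ᵥ S.rot n = S.gdot n C - S.grad B ⬝ᵥ S.rot n := by
    rw [hT.divT_starT, rot, (S.tang_grad n).star_dotProduct_star, hdiv, add_dotProduct,
      star_dotProduct_comm, S.gdot_comm, gdot, ← sub_eq_add_neg]
  rw [hquad, map_sub, hT.integral_dotProduct_grad_dotProduct_rot_lin,
    hT.starT.integral_dotProduct_grad_dotProduct_rot_lin, hrot, hrot_star, mul_add, mul_sub,
    map_add, map_sub, integral_mul_grad_dotProduct_rot, integral_mul_grad_dotProduct_rot]
  ring

lemma integral_quadRot_shearPair (a : Fin 3 → ℝ) (b c : A) :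
    S.integral (S.quadRot (S.shearPair b c) (S.lin a))
      = -2 * S.integral (S.lap b * (S.lin a * S.lap c - S.gdot (S.lin a) (S.lap c)
          - 4 * S.gdot (S.lin a) c)) := by
  set n := S.lin a
  set C := S.lap c + 2 * c
  set u := n * c + S.gdot n c with hu
  have hlap : S.lap u = S.gdot n C - n * C := S.lap_lin_mul_add_gdot a c
  have hparts : S.integral ((S.lap b + 2 * b) * S.lap u)
      = S.integral (S.lap b * (S.lap u + 2 * u)) := by
    rw [add_mul, mul_add, map_add S.integral, map_add S.integral, mul_assoc,
      mul_left_comm _ (2 : A), integral_two_mul, integral_two_mul,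
      S.integral_mul_lap_comm b, mul_comm u]
  have hsum : S.lap u + 2 * u
      = -(n * S.lap c - S.gdot n (S.lap c) - 4 * S.gdot n c) := by
    rw [hlap, gdot_add_two_mul, hu]
    ring
  have hadd := S.integral_mul_gdot_lin_add a (S.lap b + 2 * b) C
  rw [hsum, hlap, mul_sub, mul_neg, map_sub, map_neg, mul_left_comm _ n] at hparts
  rw [(S.isSTT_shearPair b c).integral_quadRot_of_divT_eq (S.divT_shearPair b c)]
  linarith

end SphereCalculus

/-! ### Removing the low modes -/

namespace SphereCalculus

variable {A : Type*} [CommRing A] [Algebra ℝ A] (S : SphereCalculus A)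

/-- The functions without `l = 0, 1` parts. -/
def noLow : Submodule ℝ A :=
  LinearMap.ker S.integral ⊓ ⨅ i, LinearMap.ker (S.integral ∘ₗ LinearMap.mulRight ℝ (S.x i))

lemma mem_noLow {f : A} :
    f ∈ S.noLow ↔ S.integral f = 0 ∧ ∀ i, S.integral (f * S.x i) = 0 := by
  simp [noLow]

lemma integral_algebraMap_mul (r : ℝ) (f : A) :
    S.integral (algebraMap ℝ A r * f) = r * S.integral f := by
  rw [← Algebra.smul_def, map_smul, smul_eq_mul]

lemma integral_lin_mul (a : Fin 3 → ℝ) (f : A) :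
    S.integral (S.lin a * f) = ∑ i, a i * S.integral (f * S.x i) := by
  simp only [lin, Finset.sum_mul, map_sum, mul_assoc, integral_algebraMap_mul, mul_comm f]

lemma integral_lin (a : Fin 3 → ℝ) : S.integral (S.lin a) = 0 := by
  simp only [lin, map_sum, integral_algebraMap_mul, integral_x, mul_zero, Finset.sum_const_zero]

lemma integral_lin_mul_x (a : Fin 3 → ℝ) (k : Fin 3) :
    3 * S.integral (S.lin a * S.x k) = a k * S.integral 1 := by
  rw [integral_lin_mul, Finset.mul_sum]
  simp only [mul_left_comm (3 : ℝ), integral_x_mul_x, mul_ite, mul_zero, Finset.sum_ite_eq,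
    Finset.mem_univ, if_true]

variable {S} in
lemma integral_lin_mul_of_mem_noLow {f : A} (hf : f ∈ S.noLow) (a : Fin 3 → ℝ) :
    S.integral (S.lin a * f) = 0 := by
  simp only [integral_lin_mul, (S.mem_noLow.1 hf).2, mul_zero, Finset.sum_const_zero]

lemma integral_one_pos [Nontrivial A] : 0 < S.integral 1 := by
  have hnonneg := S.integral_mul_self_nonneg 1
  have hzero := S.eq_zero_of_integral_mul_self 1
  rw [mul_one] at hnonneg hzero
  exact hnonneg.lt_of_ne' fun h => one_ne_zero (hzero h)

/-- The part of `f` with modes `l ≥ 2`. -/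
def highModes (f : A) : A :=
  f - algebraMap ℝ A (S.integral f / S.integral 1)
    - S.lin fun i => 3 * S.integral (f * S.x i) / S.integral 1

lemma highModes_mem_noLow [Nontrivial A] (f : A) : S.highModes f ∈ S.noLow := by
  have hV := S.integral_one_pos.ne'
  refine S.mem_noLow.2 ⟨?_, fun k => ?_⟩
  · have hmean := S.integral_algebraMap_mul (S.integral f / S.integral 1) 1
    rw [mul_one, div_mul_cancel₀ _ hV] at hmean
    rw [highModes, map_sub, map_sub, hmean, integral_lin, sub_self, sub_zero]
  · have hdipole := S.integral_lin_mul_x (fun i => 3 * S.integral (f * S.x i) / S.integral 1) k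
    rw [div_mul_cancel₀ _ hV] at hdipole
    rw [highModes, sub_mul, sub_mul, map_sub, map_sub, integral_algebraMap_mul, integral_x]
    linarith

lemma bilap_algebraMap (r : ℝ) : S.bilap (algebraMap ℝ A r) = 0 := by
  rw [bilap_eq, lap_algebraMap, zero_add, lap_two_mul, lap_algebraMap, mul_zero]

lemma bilap_highModes (f : A) : S.bilap (S.highModes f) = S.bilap f := by
  rw [highModes, map_sub, map_sub, bilap_algebraMap, bilap_lin, sub_zero, sub_zero]

variable {S} in
lemma IsSTT.div_divT_mem_noLow {T : Fin 3 → Fin 3 → A} (hT : S.IsSTT T) :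
    S.div (S.divT T) ∈ S.noLow :=
  S.mem_noLow.2 ⟨hT.tang_divT.integral_div, hT.integral_div_divT_mul_x⟩

/-! ### The zonal functions `w log w` -/

lemma lap_algebraMap_sub_lin (κ : ℝ) (a : Fin 3 → ℝ) :
    S.lap (algebraMap ℝ A κ - S.lin a) = 2 * S.lin a := by
  rw [map_sub, lap_algebraMap, lap_lin, zero_sub, neg_mul, neg_neg]

lemma gdot_algebraMap_sub_lin (κ : ℝ) {a : Fin 3 → ℝ} (ha : ∑ i, a i ^ 2 = 1) :
    S.gdot (algebraMap ℝ A κ - S.lin a) (algebraMap ℝ A κ - S.lin a)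
      = 1 - S.lin a * S.lin a := by
  rw [← S.gdot_lin_self ha]
  simp only [gdot_eq, map_sub, Derivation.map_algebraMap, zero_sub, neg_mul_neg]

section Log

variable {S} {v w l : A}

lemma gdot_of_d_eq (hl : ∀ k, S.d k l = v * S.d k w) (f : A) :
    S.gdot l f = v * S.gdot w f := by
  simp only [gdot_eq, hl]
  ring

lemma d_of_mul_eq_one (hv : w * v = 1) (k : Fin 3) : S.d k v = -(v * v) * S.d k w := by
  rw [(S.d k).leibniz_of_mul_eq_one ((mul_comm v w).trans hv), smul_eq_mul, sq]

lemma lap_of_mul_eq_one (hv : w * v = 1) :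
    S.lap v = 2 * v ^ 3 * S.gdot w w - v * v * S.lap w := by
  have hvv : S.gdot (-(v * v)) w = 2 * v ^ 3 * S.gdot w w := by
    rw [gdot_of_d_eq (v := 2 * v ^ 3) (w := w)]
    intro k
    simp only [map_neg, Derivation.leibniz, smul_eq_mul, d_of_mul_eq_one hv]
    ring
  rw [S.lap_of_d_eq (d_of_mul_eq_one hv), hvv]
  ring

lemma lap_log (hv : w * v = 1) (hl : ∀ k, S.d k l = v * S.d k w) :
    S.lap l = v * S.lap w - v * v * S.gdot w w := by
  rw [S.lap_of_d_eq hl, gdot_of_d_eq (d_of_mul_eq_one hv)]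
  ring

lemma lap_mul_log (hv : w * v = 1) (hl : ∀ k, S.d k l = v * S.d k w) :
    S.lap (w * l) = S.lap w * (l + 1) + v * S.gdot w w := by
  rw [lap_mul, lap_log hv hl, S.gdot_comm w l, gdot_of_d_eq hl]
  linear_combination (S.lap w - v * S.gdot w w) * hv

end Log

/-- Here `v` and `l` stand for `w⁻¹` and `log w`. -/
lemma bilap_mul_log {a : Fin 3 → ℝ} (ha : ∑ i, a i ^ 2 = 1) (κ : ℝ) {w v l : A}
    (hw : w = algebraMap ℝ A κ - S.lin a) (hv : w * v = 1) (hl : ∀ k, S.d k l = v * S.d k w) :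
    S.bilap (w * l) = algebraMap ℝ A (2 * (κ ^ 2 - 1) ^ 2) * v ^ 3 - algebraMap ℝ A (2 * κ)
      - 6 * S.lin a := by
  set K := algebraMap ℝ A κ with hK
  have hn : S.lin a = K - w := by rw [hw, sub_sub_cancel]
  have hlapw : S.lap w = 2 * (K - w) := by rw [← hn, hw, lap_algebraMap_sub_lin]
  have hgrad : S.gdot w w = 1 - (K - w) * (K - w) := by
    rw [← hn, hw, S.gdot_algebraMap_sub_lin κ ha]
  have hfirst : S.lap (w * l) + 2 * (w * l) = algebraMap ℝ A (2 * κ) * l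
      - algebraMap ℝ A (κ ^ 2 - 1) * v + algebraMap ℝ A (4 * κ) - algebraMap ℝ A 3 * w := by
    rw [lap_mul_log hv hl, hlapw, hgrad]
    simp only [map_mul, map_sub, map_pow, map_one, map_ofNat, ← hK]
    linear_combination (2 * K - w) * hv
  rw [bilap_eq, hfirst, map_sub, map_add, map_sub, lap_algebraMap_mul, lap_algebraMap_mul,
    lap_algebraMap_mul, lap_algebraMap, lap_log hv hl, lap_of_mul_eq_one hv, hlapw, hgrad, hn]
  simp only [map_mul, map_sub, map_pow, map_one, map_ofNat, ← hK]
  linear_combination (-4 * K - 4 * K ^ 2 * v + 2 * K * (w * v + 1) - 2 * (K ^ 2 - 1) * v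
    - 4 * K * (K ^ 2 - 1) * v ^ 2 + 2 * (K ^ 2 - 1) * v * (w * v + 1)) * hv

end SphereCalculus

/-! ### The calculus of smooth functions on the sphere -/

/-- The algebra of smooth functions on the sphere. -/
abbrev SmoothFn : Type := ContMDiffMap (𝓡 2) 𝓘(ℝ, ℝ) S2 ℝ ∞

namespace SmoothFn

lemma smooth (f : SmoothFn) : Smooth f := f.contMDiff

lemma continuous (f : SmoothFn) : Continuous f := f.smooth.continuous

lemma integrable (f : SmoothFn) : Integrable f area := integrable_of_continuous f.continuous

lemma sum_apply {ι : Type*} (s : Finset ι) (f : ι → SmoothFn) (p : S2) :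
    (∑ i ∈ s, f i) p = ∑ i ∈ s, f i p :=
  map_sum (ContMDiffMap.evalRingHom p) f s

/-- The coordinates as smooth functions. -/
def coord (i : Fin 3) : SmoothFn := ⟨fun p => (p : E3) i, smooth_coord i⟩

/-- The tangential derivatives as derivations. -/
def tderiv (k : Fin 3) : Derivation ℝ SmoothFn SmoothFn where
  toFun f := ⟨tder k f, f.smooth.tder k⟩
  map_add' f g := ContMDiffMap.ext fun p => tder_add f.smooth g.smooth k p
  map_smul' r f := ContMDiffMap.ext fun p => by
    have hmul := tder_mul (f := fun _ => r) (g := f) contMDiff_const f.smooth k p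
    rwa [tder_const, mul_zero, add_zero] at hmul
  map_one_eq_zero' := ContMDiffMap.ext fun p => tder_const k 1 p
  leibniz' f g := ContMDiffMap.ext fun p => tder_mul f.smooth g.smooth k p

/-- Integration of smooth functions. -/
def areaIntegral : SmoothFn →ₗ[ℝ] ℝ where
  toFun f := ∫ p, f p ∂area
  map_add' f g := integral_add f.integrable g.integrable
  map_smul' r _ := integral_const_mul r _

lemma sum_coord_mul_coord : ∑ i, coord i * coord i = 1 :=
  ContMDiffMap.ext fun p => (sum_apply _ _ p).trans (sum_coord_mul_self p)

lemma sum_coord_mul_tderiv (f : SmoothFn) : ∑ i, coord i * tderiv i f = 0 :=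
  ContMDiffMap.ext fun p => (sum_apply _ _ p).trans (sum_coord_mul_tder f.smooth p)

lemma tderiv_coord (k i : Fin 3) :
    tderiv k (coord i) = (if i = k then 1 else 0) - coord i * coord k :=
  ContMDiffMap.ext fun p => (tder_coord i k p).trans (by split_ifs <;> rfl)

lemma areaIntegral_rotation (f : SmoothFn) (j k : Fin 3) :
    areaIntegral (coord j * tderiv k f - coord k * tderiv j f) = 0 := by
  by_cases hjk : j = k
  · rw [hjk, sub_self, map_zero]
  · exact integral_coord_mul_tder_sub f.smooth hjk

lemma areaIntegral_tderiv (k : Fin 3) (f : SmoothFn) :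
    areaIntegral (tderiv k f) = 2 * areaIntegral (coord k * f) := by
  have hsq := sum_coord_mul_coord
  have hradial := sum_coord_mul_tderiv f
  have hδ : ∑ j, coord j * (if j = k then 1 else 0) = coord k := by simp
  rw [Fin.sum_univ_three] at hsq hradial hδ
  have hrot : tderiv k f
      = ∑ j, (coord j * tderiv k (coord j * f) - coord k * tderiv j (coord j * f))
        + (2 : ℝ) • (coord k * f) := by
    simp only [Fin.sum_univ_three, Algebra.smul_def, map_ofNat, Derivation.leibniz,
      tderiv_coord, if_true]
    linear_combination (-tderiv k f) * hsq + coord k * hradial - f * hδ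
  conv_lhs => rw [hrot, map_add, map_sum, map_smul, smul_eq_mul]
  simp only [areaIntegral_rotation, Finset.sum_const_zero, zero_add]

lemma eq_zero_of_areaIntegral_mul_self {f : SmoothFn} (hf : areaIntegral (f * f) = 0) :
    f = 0 := by
  have hae : (fun p => f p * f p) =ᵐ[area] 0 :=
    (integral_eq_zero_iff_of_nonneg (fun p => mul_self_nonneg (f p)) (f * f).integrable).1 hf
  have hzero : (fun p => f p * f p) = 0 :=
    ((f.continuous.mul f.continuous).ae_eq_iff_eq area continuous_const).1 hae
  exact ContMDiffMap.ext fun p => mul_self_eq_zero.1 (congrFun hzero p)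

end SmoothFn

open SmoothFn in
/-- The calculus of smooth functions on the unit sphere. -/
def sphereCalculus : SphereCalculus SmoothFn where
  d := tderiv
  x := coord
  integral := areaIntegral
  sum_x_mul_x := sum_coord_mul_coord
  sum_x_mul_d := sum_coord_mul_tderiv
  d_x := tderiv_coord
  d_d j k f := ContMDiffMap.ext fun p => by
    have hcomm := tder_comm f.smooth j k p
    change tder j (tder k f) p = tder k (tder j f) p + (p : E3) j * tder k f p
      - (p : E3) k * tder j f p
    linarith
  integral_d := areaIntegral_tderiv
  integral_mul_self_nonneg f := integral_nonneg fun p => mul_self_nonneg (f p)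
  eq_zero_of_integral_mul_self _ := eq_zero_of_areaIntegral_mul_self

instance : Nontrivial SmoothFn where
  exists_pair_ne := ⟨0, 1, fun h => zero_ne_one
    (congrArg (fun f : SmoothFn => f ⟨EuclideanSpace.single 0 1, by simp⟩) h)⟩

/-! ### The fundamental solution of `D²(D² + 2)` -/

section FundamentalSolution

open Filter Topology

lemma lin_apply (a : Fin 3 → ℝ) (p : S2) : sphereCalculus.lin a p = ∑ i, a i * (p : E3) i :=
  SmoothFn.sum_apply _ _ p

/-- The function `κ - ⟨q, ·⟩`. -/
def shifted (κ : ℝ) (q : S2) : SmoothFn :=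
  algebraMap ℝ SmoothFn κ - sphereCalculus.lin fun i => (q : E3) i

lemma shifted_apply (κ : ℝ) (q p : S2) : shifted κ q p = κ - inner ℝ (q : E3) (p : E3) := by
  rw [real_inner_comm, PiLp.inner_apply]
  exact congrArg (κ - ·) (lin_apply _ p)

lemma inner_le_one (q p : S2) : inner ℝ (q : E3) (p : E3) ≤ 1 :=
  (real_inner_le_norm _ _).trans (by simp)

lemma shifted_pos {κ : ℝ} (hκ : 1 < κ) (q p : S2) : 0 < shifted κ q p := by
  rw [shifted_apply]
  linarith [inner_le_one q p]

lemma Smooth.comp_left {f : S2 → ℝ} (hf : Smooth f) {φ : ℝ → ℝ}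
    (hφ : ∀ p, ContDiffAt ℝ ∞ φ (f p)) : Smooth fun p => φ (f p) :=
  fun p => (hφ p).contMDiffAt.comp p (hf p)

lemma bilap_shifted_mul_log {κ : ℝ} {q : S2} {v l : SmoothFn} (hκ : 1 < κ)
    (hv : ∀ p, v p = (shifted κ q p)⁻¹) (hl : ∀ p, l p = Real.log (shifted κ q p)) :
    sphereCalculus.bilap (shifted κ q * l)
      = algebraMap ℝ SmoothFn (2 * (κ ^ 2 - 1) ^ 2) * v ^ 3 - algebraMap ℝ SmoothFn (2 * κ)
        - 6 * sphereCalculus.lin fun i => (q : E3) i := by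
  refine sphereCalculus.bilap_mul_log ?_ κ rfl (ContMDiffMap.ext fun p => ?_)
    fun k => ContMDiffMap.ext fun p => ?_
  · simpa only [sq] using sum_coord_mul_self q
  · exact (congrArg (_ * ·) (hv p)).trans (mul_inv_cancel₀ (shifted_pos hκ q p).ne')
  · have hlog := tder_comp (shifted κ q).smooth (Real.hasDerivAt_log (shifted_pos hκ q p).ne') k
    rw [← funext hl, ← hv] at hlog
    exact hlog

/-- The kernel `(κ - z) log (κ - z)`.  For `κ = 1` it is, up to a factor and low modes, the Green
function of `D²(D² + 2)`; for `κ > 1` it is smooth on the sphere. -/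
def greenKernel (κ z : ℝ) : ℝ := (κ - z) * Real.log (κ - z)

/-- The image of `greenKernel κ ⟨q, ·⟩` under `D²(D² + 2)` without its low modes, normalized to
become an approximate identity as `κ → 1`. -/
def peak (κ : ℝ) (q p : S2) : ℝ :=
  (κ ^ 2 - 1) ^ 2 / SmoothFn.areaIntegral 1 * (κ - inner ℝ (q : E3) (p : E3))⁻¹ ^ 3

lemma areaIntegral_one_pos : 0 < SmoothFn.areaIntegral 1 := sphereCalculus.integral_one_pos

lemma continuous_greenKernel : Continuous fun z : ℝ × ℝ => greenKernel z.1 z.2 :=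
  Real.continuous_mul_log.comp (continuous_fst.sub continuous_snd)

lemma peak_nonneg {κ : ℝ} (hκ : 1 < κ) (q p : S2) : 0 ≤ peak κ q p := by
  have hpos := shifted_pos hκ q p
  have hV := areaIntegral_one_pos
  rw [shifted_apply] at hpos
  rw [peak]
  positivity

lemma continuous_peak {κ : ℝ} (hκ : 1 < κ) (q : S2) : Continuous (peak κ q) := by
  have hne (p : S2) : κ - inner ℝ (q : E3) (p : E3) ≠ 0 := by
    rw [← shifted_apply]
    exact (shifted_pos hκ q p).ne'
  unfold peak
  fun_prop (disch := exact hne _)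

lemma integral_greenKernel_mul_bilap_of_one_lt {κ : ℝ} (hκ : 1 < κ) (q : S2) (f : SmoothFn) :
    ∫ p : S2, greenKernel κ (inner ℝ (q : E3) (p : E3)) * sphereCalculus.bilap f p ∂area
      = 2 * SmoothFn.areaIntegral 1 * (∫ p, peak κ q p * f p ∂area)
        - 2 * κ * SmoothFn.areaIntegral f
        - 6 * SmoothFn.areaIntegral (sphereCalculus.lin (fun i => (q : E3) i) * f) := by
  have hne (p : S2) := (shifted_pos hκ q p).ne'
  let v : SmoothFn := ⟨fun p => (shifted κ q p)⁻¹,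
    (shifted κ q).smooth.comp_left fun p => contDiffAt_inv ℝ (hne p)⟩
  let l : SmoothFn := ⟨fun p => Real.log (shifted κ q p),
    (shifted κ q).smooth.comp_left fun p => Real.contDiffAt_log.2 (hne p)⟩
  have hparts := sphereCalculus.integral_mul_bilap_comm f (shifted κ q * l)
  have hexpand : f * (algebraMap ℝ SmoothFn (2 * (κ ^ 2 - 1) ^ 2) * v ^ 3
      - algebraMap ℝ SmoothFn (2 * κ) - 6 * sphereCalculus.lin fun i => (q : E3) i)
      = algebraMap ℝ SmoothFn (2 * (κ ^ 2 - 1) ^ 2) * (v ^ 3 * f)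
        - algebraMap ℝ SmoothFn (2 * κ) * f
        - algebraMap ℝ SmoothFn 6 * (sphereCalculus.lin (fun i => (q : E3) i) * f) := by
    rw [map_ofNat]
    ring
  have hpeak : ∫ p, peak κ q p * f p ∂area
      = (κ ^ 2 - 1) ^ 2 / SmoothFn.areaIntegral 1 * SmoothFn.areaIntegral (v ^ 3 * f) := by
    refine Eq.trans ?_ (integral_const_mul _ _)
    refine integral_congr_ae (.of_forall fun p => ?_)
    simp only [peak, ← shifted_apply, mul_assoc]
    rfl
  have hkernel : ∫ p : S2, greenKernel κ (inner ℝ (q : E3) (p : E3))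
        * sphereCalculus.bilap f p ∂area
      = sphereCalculus.integral (shifted κ q * l * sphereCalculus.bilap f) := by
    refine integral_congr_ae (.of_forall fun p => ?_)
    simp only [greenKernel, ← shifted_apply]
    rfl
  rw [bilap_shifted_mul_log (v := v) (l := l) hκ (fun _ => rfl) (fun _ => rfl), hexpand,
    map_sub, map_sub, sphereCalculus.integral_algebraMap_mul,
    sphereCalculus.integral_algebraMap_mul, sphereCalculus.integral_algebraMap_mul] at hparts
  rw [hkernel, ← hparts, hpeak]
  have hV := areaIntegral_one_pos.ne'
  field_simp
  rfl

lemma integral_peak {κ : ℝ} (hκ : 1 < κ) (q : S2) : ∫ p, peak κ q p ∂area = κ := by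
  have hone := integral_greenKernel_mul_bilap_of_one_lt hκ q 1
  have hbilap : sphereCalculus.bilap (1 : SmoothFn) = 0 := by
    simpa only [map_one] using sphereCalculus.bilap_algebraMap 1
  have hlin : SmoothFn.areaIntegral (sphereCalculus.lin fun i => (q : E3) i) = 0 :=
    sphereCalculus.integral_lin _
  simp only [hbilap, hlin, ContMDiffMap.coe_zero, ContMDiffMap.coe_one, Pi.zero_apply,
    Pi.one_apply, mul_zero, mul_one, integral_zero, sub_zero] at hone
  have hV := areaIntegral_one_pos.ne'
  have : 2 * SmoothFn.areaIntegral 1 * ((∫ p, peak κ q p ∂area) - κ) = 0 := by linarith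
  exact sub_eq_zero.1 ((mul_eq_zero.1 this).resolve_left (by positivity))

lemma exists_pos_le_one_sub_inner {u : Set S2} (hu : IsOpen u) {q : S2} (hq : q ∈ u) :
    ∃ δ > 0, ∀ p ∈ uᶜ, δ ≤ 1 - inner ℝ (q : E3) (p : E3) := by
  refine hu.isClosed_compl.isCompact.exists_forall_le' (by fun_prop) fun p hp => ?_
  refine sub_pos.2 ((inner_le_one q p).lt_of_ne fun h => hp ?_)
  rwa [← Subtype.ext ((inner_eq_one_iff_of_norm_eq_one (norm_eq_of_mem_sphere q)
    (norm_eq_of_mem_sphere p)).1 h)]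

lemma tendstoUniformlyOn_peak {u : Set S2} (hu : IsOpen u) {q : S2} (hq : q ∈ u) :
    TendstoUniformlyOn (fun κ => peak κ q) 0 (𝓝[>] 1) uᶜ := by
  obtain ⟨δ, hδ, hδu⟩ := exists_pos_le_one_sub_inner hu hq
  have hV := areaIntegral_one_pos
  have hbound : Tendsto (fun κ : ℝ => (κ ^ 2 - 1) ^ 2 / SmoothFn.areaIntegral 1 * δ⁻¹ ^ 3)
      (𝓝[>] 1) (𝓝 0) := by
    have hcont : Continuous fun κ : ℝ =>
        (κ ^ 2 - 1) ^ 2 / SmoothFn.areaIntegral 1 * δ⁻¹ ^ 3 := by fun_prop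
    simpa using (hcont.tendsto 1).mono_left nhdsWithin_le_nhds
  rw [Metric.tendstoUniformlyOn_iff]
  intro ε hε
  filter_upwards [self_mem_nhdsWithin, hbound.eventually (gt_mem_nhds hε)] with κ hκ hκε p hp
  rw [Pi.zero_apply, dist_zero_left, Real.norm_of_nonneg (peak_nonneg hκ q p)]
  refine lt_of_le_of_lt ?_ hκε
  rw [Set.mem_Ioi] at hκ
  have hle : δ ≤ κ - inner ℝ (q : E3) (p : E3) := (hδu p hp).trans (by gcongr)
  have hpos : 0 < κ - inner ℝ (q : E3) (p : E3) := hδ.trans_le hle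
  rw [peak]
  gcongr

lemma tendsto_integral_peak_mul (q : S2) (f : SmoothFn) :
    Tendsto (fun κ => ∫ p, peak κ q p * f p ∂area) (𝓝[>] 1) (𝓝 (f q)) := by
  refine tendsto_integral_peak_smul_of_integrable_of_tendsto (t := Set.univ) MeasurableSet.univ
    univ_mem (measure_ne_top _ _) ?_ (fun u hu hq => tendstoUniformlyOn_peak hu hq) ?_ ?_
    f.integrable f.continuous.continuousAt
  · filter_upwards [self_mem_nhdsWithin] with κ hκ p using peak_nonneg hκ q p
  · have hid : Tendsto (fun κ : ℝ => κ) (𝓝[>] 1) (𝓝 1) := nhdsWithin_le_nhds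
    refine hid.congr' ?_
    filter_upwards [self_mem_nhdsWithin] with κ hκ
    rw [setIntegral_univ, integral_peak hκ]
  · filter_upwards [self_mem_nhdsWithin] with κ hκ
    exact (continuous_peak hκ q).aestronglyMeasurable

lemma integral_greenKernel_mul_bilap (q : S2) (f : SmoothFn) :
    ∫ p : S2, greenKernel 1 (inner ℝ (q : E3) (p : E3)) * sphereCalculus.bilap f p ∂area
      = 2 * SmoothFn.areaIntegral 1 * f q - 2 * SmoothFn.areaIntegral f
        - 6 * SmoothFn.areaIntegral (sphereCalculus.lin (fun i => (q : E3) i) * f) := by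
  have hid : Tendsto (fun κ : ℝ => κ) (𝓝[>] 1) (𝓝 1) := nhdsWithin_le_nhds
  have hcont : Continuous fun κ : ℝ => ∫ p : S2 in Set.univ,
      greenKernel κ (inner ℝ (q : E3) (p : E3)) * sphereCalculus.bilap f p ∂area := by
    refine continuous_parametric_integral_of_continuous (f := fun (κ : ℝ) (p : S2) =>
      greenKernel κ (inner ℝ (q : E3) (p : E3)) * sphereCalculus.bilap f p) ?_ isCompact_univ
    have hinner : Continuous fun z : ℝ × S2 => (z.1, inner ℝ (q : E3) (z.2 : E3)) := by fun_prop
    exact (continuous_greenKernel.comp hinner).mul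
      ((SmoothFn.continuous _).comp continuous_snd)
  simp only [setIntegral_univ] at hcont
  have hleft := (hcont.tendsto 1).mono_left (nhdsWithin_le_nhds (s := Set.Ioi 1))
  have hright := (((tendsto_integral_peak_mul q f).const_mul (2 * SmoothFn.areaIntegral 1)).sub
    ((hid.const_mul 2).mul_const (SmoothFn.areaIntegral f))).sub_const
      (6 * SmoothFn.areaIntegral (sphereCalculus.lin (fun i => (q : E3) i) * f))
  rw [mul_one] at hright
  refine tendsto_nhds_unique (hleft.congr' ?_) hright
  filter_upwards [self_mem_nhdsWithin] with κ hκ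
  exact integral_greenKernel_mul_bilap_of_one_lt hκ q f

end FundamentalSolution

/-! ### Solving `D²(D² + 2) u = g` -/

section Solve

variable {f g : SmoothFn} {T : Fin 3 → Fin 3 → SmoothFn}

lemma eq_zero_of_bilap_eq_zero (hf : f ∈ sphereCalculus.noLow)
    (hbilap : sphereCalculus.bilap f = 0) : f = 0 := by
  refine ContMDiffMap.ext fun q => ?_
  have hgreen := integral_greenKernel_mul_bilap q f
  have hmean : SmoothFn.areaIntegral f = 0 := (sphereCalculus.mem_noLow.1 hf).1
  have hdipole : SmoothFn.areaIntegral (sphereCalculus.lin (fun i => (q : E3) i) * f) = 0 :=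
    SphereCalculus.integral_lin_mul_of_mem_noLow hf _
  have hV := areaIntegral_one_pos
  simpa [hbilap, hmean, hdipole, hV.ne'] using hgreen

lemma eq_of_bilap_eq (hf : f ∈ sphereCalculus.noLow) (hg : g ∈ sphereCalculus.noLow)
    (hbilap : sphereCalculus.bilap f = sphereCalculus.bilap g) : f = g :=
  sub_eq_zero.1 <| eq_zero_of_bilap_eq_zero (sphereCalculus.noLow.sub_mem hf hg) <| by
    rw [map_sub, hbilap, sub_self]

/-- Convolution with the Green kernel. -/
def greenConv (g : SmoothFn) : SmoothFn where
  val p := ∫ q : S2, greenKernel 1 (inner ℝ (p : E3) (q : E3)) * g q ∂area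
  property := smooth_zonal_convolution g.smooth
    (continuous_greenKernel.comp (Continuous.prodMk_right 1))

lemma areaIntegral_greenConv_mul (g f : SmoothFn) :
    SmoothFn.areaIntegral (greenConv g * f)
      = ∫ q : S2, g q * ∫ p : S2, greenKernel 1 (inner ℝ (q : E3) (p : E3)) * f p ∂area ∂area := by
  have hcont : Continuous (Function.uncurry fun p q : S2 =>
      greenKernel 1 (inner ℝ (p : E3) (q : E3)) * g q * f p) := by
    have hinner : Continuous fun z : S2 × S2 => ((1 : ℝ), inner ℝ (z.1 : E3) (z.2 : E3)) := by
      fun_prop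
    exact ((continuous_greenKernel.comp hinner).mul (g.continuous.comp continuous_snd)).mul
      (f.continuous.comp continuous_fst)
  calc SmoothFn.areaIntegral (greenConv g * f)
      = ∫ p : S2, ∫ q : S2, greenKernel 1 (inner ℝ (p : E3) (q : E3)) * g q * f p ∂area ∂area :=
        integral_congr_ae (.of_forall fun p => (integral_mul_const (f p) _).symm)
    _ = ∫ q : S2, ∫ p : S2, greenKernel 1 (inner ℝ (p : E3) (q : E3)) * g q * f p ∂area ∂area :=
        integral_integral_swap (integrable_of_continuous hcont)
    _ = _ := by
        refine integral_congr_ae (.of_forall fun q => ?_)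
        simp only [← integral_const_mul, real_inner_comm, mul_assoc, mul_left_comm (g q)]

lemma areaIntegral_greenConv_mul_bilap (hg : g ∈ sphereCalculus.noLow) (f : SmoothFn) :
    SmoothFn.areaIntegral (greenConv g * sphereCalculus.bilap f)
      = 2 * SmoothFn.areaIntegral 1 * SmoothFn.areaIntegral (g * f) := by
  set a : Fin 3 → ℝ := fun i => SmoothFn.areaIntegral (f * SmoothFn.coord i)
  have hdipole (q : S2) : SmoothFn.areaIntegral (sphereCalculus.lin (fun i => (q : E3) i) * f)
      = sphereCalculus.lin a q := by
    rw [lin_apply]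
    exact (sphereCalculus.integral_lin_mul _ f).trans
      (Finset.sum_congr rfl fun i _ => mul_comm _ _)
  have hgreen : SmoothFn.areaIntegral (greenConv g * sphereCalculus.bilap f)
      = sphereCalculus.integral (algebraMap ℝ SmoothFn (2 * SmoothFn.areaIntegral 1) * (g * f)
        - algebraMap ℝ SmoothFn (2 * SmoothFn.areaIntegral f) * g
        - algebraMap ℝ SmoothFn 6 * (sphereCalculus.lin a * g)) := by
    rw [areaIntegral_greenConv_mul]
    refine integral_congr_ae (.of_forall fun q => ?_)
    simp only [integral_greenKernel_mul_bilap, hdipole]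
    change _ = 2 * SmoothFn.areaIntegral 1 * (g q * f q) - 2 * SmoothFn.areaIntegral f * g q
      - 6 * (sphereCalculus.lin a q * g q)
    ring
  rw [hgreen, map_sub, map_sub, sphereCalculus.integral_algebraMap_mul,
    sphereCalculus.integral_algebraMap_mul, sphereCalculus.integral_algebraMap_mul,
    (sphereCalculus.mem_noLow.1 hg).1, SphereCalculus.integral_lin_mul_of_mem_noLow hg, mul_zero,
    mul_zero, sub_zero, sub_zero]
  rfl

lemma bilap_greenConv (hg : g ∈ sphereCalculus.noLow) :
    sphereCalculus.bilap (greenConv g)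
      = algebraMap ℝ SmoothFn (2 * SmoothFn.areaIntegral 1) * g := by
  set r := sphereCalculus.bilap (greenConv g)
    - algebraMap ℝ SmoothFn (2 * SmoothFn.areaIntegral 1) * g
  have hweak : sphereCalculus.integral (r * sphereCalculus.bilap (greenConv g))
      = 2 * SmoothFn.areaIntegral 1 * sphereCalculus.integral (g * r) :=
    (sphereCalculus.integral_mul_bilap_comm r (greenConv g)).trans
      (areaIntegral_greenConv_mul_bilap hg r)
  have hsq : r * r = r * sphereCalculus.bilap (greenConv g)
      - algebraMap ℝ SmoothFn (2 * SmoothFn.areaIntegral 1) * (g * r) := by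
    ring
  refine sub_eq_zero.1 (sphereCalculus.eq_zero_of_integral_mul_self r ?_)
  rw [hsq, map_sub, hweak, sphereCalculus.integral_algebraMap_mul, sub_self]

lemma exists_mem_noLow_bilap_eq (hg : g ∈ sphereCalculus.noLow) :
    ∃ u ∈ sphereCalculus.noLow, sphereCalculus.bilap u = g := by
  refine ⟨_, sphereCalculus.highModes_mem_noLow ((2 * SmoothFn.areaIntegral 1)⁻¹ • greenConv g), ?_⟩
  have hV := areaIntegral_one_pos
  rw [sphereCalculus.bilap_highModes, map_smul, bilap_greenConv hg, ← Algebra.smul_def,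
    inv_smul_smul₀ (by positivity)]

lemma exists_shearPair_eq (hT : sphereCalculus.IsSTT T) :
    ∃ b ∈ sphereCalculus.noLow, ∃ c ∈ sphereCalculus.noLow, T = sphereCalculus.shearPair b c := by
  obtain ⟨c, hc, hcT⟩ := exists_mem_noLow_bilap_eq hT.div_divT_mem_noLow
  obtain ⟨b, hb, hbT⟩ := exists_mem_noLow_bilap_eq hT.starT.div_divT_mem_noLow
  refine ⟨-b, neg_mem hb, c, hc, hT.eq_of_div_divT_eq (sphereCalculus.isSTT_shearPair _ _) ?_ ?_⟩
  · rw [sphereCalculus.div_divT_shearPair, hcT]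
  · rw [sphereCalculus.div_star_divT_shearPair, map_neg, neg_neg, hbT, hT.divT_starT]

end Solve

/-! ### Comparison with the Cartesian components -/

section Comparison

open Matrix

variable {T : Fin 3 → Fin 3 → SmoothFn}

lemma sum_metric_mul (p : S2) (i : Fin 3) (v : Fin 3 → ℝ) :
    ∑ a, metric p i a * v a = v i - (p : E3) i * ∑ a, (p : E3) a * v a := by
  simp only [metric, sub_mul, Finset.sum_sub_distrib, ite_mul, one_mul, zero_mul,
    Finset.sum_ite_eq, Finset.mem_univ, if_true, Finset.mul_sum, mul_assoc]

lemma sum_eps_mul (p : S2) (i : Fin 3) (v : Fin 3 → ℝ) :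
    ∑ k, eps p i k * v k = (v ⨯₃ fun k => (p : E3) k) i := by
  fin_cases i <;>
  · simp [eps, det_fin_three, cross_apply, Fin.sum_univ_three]
    ring

lemma eps_antisymm (p : S2) (i j : Fin 3) : eps p j i = -eps p i j := by
  simp only [eps, det_fin_three, of_apply, cons_val]
  ring

lemma sum_eps_mul_metric (p : S2) (i j : Fin 3) :
    ∑ k, eps p i k * metric p k j = eps p i j := by
  have hself : ∑ k, eps p i k * (p : E3) k = 0 := by
    rw [sum_eps_mul, cross_self, Pi.zero_apply]
  simp only [metric, mul_sub, mul_ite, mul_one, mul_zero, Finset.sum_sub_distrib,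
    Finset.sum_ite_eq', Finset.mem_univ, if_true, ← mul_assoc, ← Finset.sum_mul, hself, zero_mul,
    sub_zero]

lemma ofNat_mul_apply (k : ℕ) [k.AtLeastTwo] (f : SmoothFn) (p : S2) :
    ((OfNat.ofNat k : SmoothFn) * f) p = (OfNat.ofNat k : ℝ) * f p := by
  rw [← map_ofNat (algebraMap ℝ SmoothFn) k]
  rfl

lemma dotProduct_apply (v w : Fin 3 → SmoothFn) (p : S2) :
    (v ⬝ᵥ w) p = ∑ i, v i p * w i p :=
  SmoothFn.sum_apply _ _ p

lemma hess_coe (f : SmoothFn) (p : S2) (i j : Fin 3) :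
    hess f p i j = (sphereCalculus.d j (sphereCalculus.d i f)
      + sphereCalculus.x i * sphereCalculus.d j f) p := by
  have hradial : ∑ a, (p : E3) a * SmoothFn.tderiv j (SmoothFn.tderiv a f) p
      = -SmoothFn.tderiv j f p := by
    rw [Fin.sum_univ_three]
    exact congrArg (fun g : SmoothFn => g p) ((sphereCalculus.tang_grad f).x_d j)
  refine (sum_metric_mul p i fun a => SmoothFn.tderiv j (SmoothFn.tderiv a f) p).trans ?_
  rw [hradial, mul_neg, sub_neg_eq_add]
  rfl

lemma div1_coe (w : Fin 3 → SmoothFn) : div1 (fun q i => w i q) = sphereCalculus.div w := by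
  funext p
  have hcov (i : Fin 3) : covD1 (fun q i => w i q) p i i = SmoothFn.tderiv i (w i) p
      - ∑ a, (p : E3) a * ((p : E3) i * SmoothFn.tderiv i (w a) p) := by
    refine (sum_metric_mul p i fun a => SmoothFn.tderiv i (w a) p).trans ?_
    simp only [Finset.mul_sum, mul_left_comm ((p : E3) i)]
  have hradial (a : Fin 3) : ∑ i, (p : E3) i * SmoothFn.tderiv i (w a) p = 0 :=
    sum_coord_mul_tder (w a).smooth p
  rw [div1, Finset.sum_congr rfl fun i _ => hcov i, Finset.sum_sub_distrib, Finset.sum_comm]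
  simp only [← Finset.mul_sum, hradial, mul_zero, Finset.sum_const_zero, sub_zero,
    Fin.sum_univ_three, sphereCalculus.div_eq]
  rfl

lemma lap_coe (f : SmoothFn) : lap f = sphereCalculus.lap f := div1_coe (sphereCalculus.grad f)

lemma gradDot_coe (f g : SmoothFn) : gradDot f g = sphereCalculus.gdot f g :=
  funext fun p => (dotProduct_apply (sphereCalculus.grad f) (sphereCalculus.grad g) p).symm

lemma star_apply (w : Fin 3 → SmoothFn) (p : S2) (i : Fin 3) :
    sphereCalculus.star w i p = ∑ k, eps p i k * w k p := by
  rw [sum_eps_mul]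
  fin_cases i <;> simp [sphereCalculus.star_eq, cross_apply] <;> rfl

lemma rot_coe (n : SmoothFn) (p : S2) (i : Fin 3) : rot n p i = sphereCalculus.rot n i p :=
  (star_apply (sphereCalculus.grad n) p i).symm

lemma div2_coe (hT : sphereCalculus.IsSTT T) :
    div2 (fun q i j => T i j q) = fun p i => sphereCalculus.divT T i p := by
  funext p i
  have htang : ∑ a, (p : E3) a * sphereCalculus.divT T a p = 0 := by
    have h := congrArg (fun g : SmoothFn => g p) ((dotProduct_comm _ _).trans hT.tang_divT)
    exact (dotProduct_apply _ _ p).symm.trans h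
  calc div2 (fun q i j => T i j q) p i
      = ∑ a, metric p i a * div1 (fun q j => T a j q) p := by
        simp only [div2, covD2, div1, covD1, Finset.mul_sum, mul_assoc]
        exact Finset.sum_comm
    _ = ∑ a, metric p i a * sphereCalculus.divT T a p := by
        simp only [div1_coe]
        rfl
    _ = sphereCalculus.divT T i p := by
        rw [sum_metric_mul, htang, mul_zero, sub_zero]

lemma shear_apply (c : SmoothFn) (p : S2) (i j : Fin 3) :
    sphereCalculus.shear c i j p = 2 * hess c p i j - metric p i j * lap c p := by
  rw [hess_coe, lap_coe, metric, ← ofNat_mul_apply]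
  change _ - ((if i = j then 1 else 0 : SmoothFn) p - (p : E3) i * (p : E3) j)
    * sphereCalculus.lap c p = _
  split_ifs <;> rfl

lemma starT_shear_apply (b : SmoothFn) (p : S2) (i j : Fin 3) :
    sphereCalculus.starT (sphereCalculus.shear b) i j p
      = 2 * (∑ k, eps p j k * hess b p k i) - eps p j i * lap b p := by
  have hsymm := (sphereCalculus.isSTT_shear b).symm i
  rw [SphereCalculus.starT, star_apply, ← sum_eps_mul_metric]
  simp only [hsymm, shear_apply, mul_sub, Finset.sum_sub_distrib, Finset.mul_sum, Finset.sum_mul,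
    mul_left_comm (2 : ℝ), mul_assoc]

lemma shearOf_coe (b c : SmoothFn) :
    shearOf b c = fun p i j => sphereCalculus.shearPair b c i j p := by
  funext p i j
  have hsymm : sphereCalculus.starT (sphereCalculus.shear b) i j p
      = sphereCalculus.starT (sphereCalculus.shear b) j i p :=
    congrArg (fun g : SmoothFn => g p) ((sphereCalculus.isSTT_shear b).starT.symm i j)
  have hstar := starT_shear_apply b p i j
  rw [starT_shear_apply, starT_shear_apply, eps_antisymm p i j] at hsymm
  change _ = sphereCalculus.shear c i j p
    + sphereCalculus.starT (sphereCalculus.shear b) i j p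
  rw [shear_apply, hstar, shearOf, eps_antisymm p i j]
  linarith

lemma sum_quad_mul_rot (hT : sphereCalculus.IsSTT T) (n : SmoothFn) (p : S2) :
    ∑ i, quad (fun q i j => T i j q) p i * rot n p i = sphereCalculus.quadRot T n p := by
  simp only [SphereCalculus.quadRot, dotProduct_apply, quad, div2_coe hT, rot_coe]

lemma isCWYPotential_coe (hT : sphereCalculus.IsSTT T) {c : SmoothFn} :
    IsCWYPotential (fun p i j => T i j p) c ↔ c ∈ sphereCalculus.noLow ∧
      sphereCalculus.bilap c = sphereCalculus.div (sphereCalculus.divT T) := by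
  have hbilap : lap (fun q => lap c q + 2 * c q) = sphereCalculus.bilap c := by
    rw [sphereCalculus.bilap_eq, ← lap_coe]
    congr 1
    funext q
    rw [lap_coe, ← ofNat_mul_apply]
    rfl
  constructor
  · intro h
    refine ⟨sphereCalculus.mem_noLow.2 h.noLow, ContMDiffMap.ext fun p => ?_⟩
    rw [← hbilap, h.eqn, div2_coe hT, div1_coe]
  · rintro ⟨hlow, heq⟩
    refine ⟨c.smooth, sphereCalculus.mem_noLow.1 hlow, fun p => ?_⟩
    rw [hbilap, heq, div2_coe hT, div1_coe]

lemma IsSymmTraceless.exists_isSTT {χ : S2 → Fin 3 → Fin 3 → ℝ} (hχ : IsSymmTraceless χ) :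
    ∃ T : Fin 3 → Fin 3 → SmoothFn, sphereCalculus.IsSTT T ∧ χ = fun p i j => T i j p := by
  refine ⟨fun i j => ⟨fun p => χ p i j, hχ.smooth i j⟩, ⟨fun i j => ?_, fun i => ?_, ?_⟩, rfl⟩
  · exact ContMDiffMap.ext fun p => hχ.symm p i j
  · exact ContMDiffMap.ext fun p => (dotProduct_apply _ _ p).trans (hχ.tangential p i)
  · exact ContMDiffMap.ext fun p => (SmoothFn.sum_apply _ _ p).trans (hχ.traceless p)

lemma IsDipole.exists_eq_lin {n : S2 → ℝ} (hn : IsDipole n) :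
    ∃ a : Fin 3 → ℝ, n = sphereCalculus.lin a := by
  obtain ⟨a, ha⟩ := hn
  refine ⟨a, funext fun p => ?_⟩
  simp only [ha, lin_apply, PiLp.inner_apply, RCLike.inner_apply, conj_trivial, mul_comm]

end Comparison

/-! ### The angular momenta -/

section AngularMomenta

open Matrix

variable {α : ℝ} {m n b c : S2 → ℝ} {N : S2 → Fin 3 → ℝ} {χ : S2 → Fin 3 → Fin 3 → ℝ}

lemma Smooth.exists_eq_coe {f : S2 → ℝ} (hf : Smooth f) : ∃ g : SmoothFn, f = g := ⟨⟨f, hf⟩, rfl⟩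

lemma IsDipole.smooth (hn : IsDipole n) : Smooth n := by
  obtain ⟨a, rfl⟩ := hn.exists_eq_lin
  exact (sphereCalculus.lin a).smooth

lemma exists_eq_shearOf (hχ : IsSymmTraceless χ) :
    ∃ b c : S2 → ℝ, Smooth b ∧ Smooth c ∧ NoLowModes b ∧ NoLowModes c ∧ χ = shearOf b c := by
  obtain ⟨T, hT, rfl⟩ := hχ.exists_isSTT
  obtain ⟨b, hb, c, hc, rfl⟩ := exists_shearPair_eq hT
  exact ⟨b, c, b.smooth, c.smooth, sphereCalculus.mem_noLow.1 hb, sphereCalculus.mem_noLow.1 hc,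
    (shearOf_coe b c).symm⟩

lemma existsUnique_isCWYPotential (hχ : IsSymmTraceless χ) : ∃! c, IsCWYPotential χ c := by
  obtain ⟨T, hT, rfl⟩ := hχ.exists_isSTT
  obtain ⟨c, hc, heq⟩ := exists_mem_noLow_bilap_eq hT.div_divT_mem_noLow
  refine ⟨c, (isCWYPotential_coe hT).2 ⟨hc, heq⟩, fun c' hc' => ?_⟩
  obtain ⟨c', rfl⟩ := hc'.smooth.exists_eq_coe
  obtain ⟨hlow, heq'⟩ := (isCWYPotential_coe hT).1 hc'
  rw [eq_of_bilap_eq hlow hc (heq'.trans heq.symm)]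

lemma isCWYPotential_shearOf (hb : Smooth b) (hc : Smooth c) (hlow : NoLowModes c) :
    IsCWYPotential (shearOf b c) c := by
  obtain ⟨b, rfl⟩ := hb.exists_eq_coe
  obtain ⟨c, rfl⟩ := hc.exists_eq_coe
  rw [shearOf_coe, isCWYPotential_coe (sphereCalculus.isSTT_shearPair b c)]
  exact ⟨sphereCalculus.mem_noLow.2 hlow, (sphereCalculus.div_divT_shearPair b c).symm⟩

lemma isSymmTraceless_shearOf (hb : Smooth b) (hc : Smooth c) :
    IsSymmTraceless (shearOf b c) := by
  obtain ⟨b, rfl⟩ := hb.exists_eq_coe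
  obtain ⟨c, rfl⟩ := hc.exists_eq_coe
  rw [shearOf_coe]
  have hT := sphereCalculus.isSTT_shearPair b c
  exact
    { smooth i j := (sphereCalculus.shearPair b c i j).smooth
      tangential p i := (dotProduct_apply _ _ p).symm.trans
        (congrArg (fun f : SmoothFn => f p) (hT.tang i))
      symm p i j := congrArg (fun f : SmoothFn => f p) (hT.symm i j)
      traceless p := (SmoothFn.sum_apply _ _ p).symm.trans
        (congrArg (fun f : SmoothFn => f p) hT.trace) }

lemma cwyPotential_shearOf (hb : Smooth b) (hc : Smooth c) (hlow : NoLowModes c) :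
    cwyPotential (shearOf b c) = c :=
  have hpot := isCWYPotential_shearOf hb hc hlow
  (existsUnique_isCWYPotential (isSymmTraceless_shearOf hb hc)).unique
    (Classical.epsilon_spec ⟨c, hpot⟩) hpot

/-- The density, in terms of the potentials, of the quadratic part of the angular momentum. -/
def potentialDensity (n b c : S2 → ℝ) (p : S2) : ℝ :=
  lap b p * (n p * lap c p - gradDot n (lap c) p - 4 * gradDot n c p)

lemma potentialDensity_coe (n b c : SmoothFn) :
    potentialDensity n b c = (sphereCalculus.lap b * (n * sphereCalculus.lap c
      - sphereCalculus.gdot n (sphereCalculus.lap c) - 4 * sphereCalculus.gdot n c) :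
        SmoothFn) := by
  funext p
  rw [potentialDensity, lap_coe, lap_coe, gradDot_coe, gradDot_coe, ← ofNat_mul_apply]
  rfl

lemma integrable_potentialDensity (hn : Smooth n) (hb : Smooth b) (hc : Smooth c) :
    Integrable (potentialDensity n b c) area := by
  obtain ⟨n, rfl⟩ := hn.exists_eq_coe
  obtain ⟨b, rfl⟩ := hb.exists_eq_coe
  obtain ⟨c, rfl⟩ := hc.exists_eq_coe
  rw [potentialDensity_coe]
  exact SmoothFn.integrable _

lemma integrable_sum_mul_rot {w : S2 → Fin 3 → ℝ} (hw : ∀ i, Smooth fun p => w p i)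
    (hn : Smooth n) : Integrable (fun p => ∑ i, w p i * rot n p i) area := by
  obtain ⟨n, rfl⟩ := hn.exists_eq_coe
  choose w' hw' using fun i => (hw i).exists_eq_coe
  simp only [rot_coe, fun p i => congrFun (hw' i) p, ← dotProduct_apply]
  exact SmoothFn.integrable _

lemma integral_quad_shearOf (hn : IsDipole n) (hb : Smooth b) (hc : Smooth c) :
    ∫ p, ∑ i, quad (shearOf b c) p i * rot n p i ∂area
      = -2 * ∫ p, potentialDensity n b c p ∂area := by
  obtain ⟨a, rfl⟩ := hn.exists_eq_lin
  obtain ⟨b, rfl⟩ := hb.exists_eq_coe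
  obtain ⟨c, rfl⟩ := hc.exists_eq_coe
  simp only [shearOf_coe, sum_quad_mul_rot (sphereCalculus.isSTT_shearPair b c),
    potentialDensity_coe]
  exact sphereCalculus.integral_quadRot_shearPair a b c

lemma lap_zero : lap 0 = 0 := (lap_coe 0).trans (congrArg _ (map_zero sphereCalculus.lap))

lemma gradDot_zero_right (n : S2 → ℝ) : gradDot n 0 = 0 := by
  have hgrad (p : S2) (i : Fin 3) : grad 0 p i = 0 := tder_const i 0 p
  funext p
  simp only [gradDot, hgrad, mul_zero, Finset.sum_const_zero, Pi.zero_apply]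

lemma integral_quad_shearOf_zero_right (hn : IsDipole n) (hb : Smooth b) :
    ∫ p, ∑ i, quad (shearOf b 0) p i * rot n p i ∂area = 0 := by
  rw [integral_quad_shearOf (c := 0) hn hb contMDiff_const]
  simp [potentialDensity, lap_zero, gradDot_zero_right]

lemma integral_quad_shearOf_zero_left (hn : IsDipole n) (hc : Smooth c) :
    ∫ p, ∑ i, quad (shearOf 0 c) p i * rot n p i ∂area = 0 := by
  rw [integral_quad_shearOf (b := 0) hn contMDiff_const hc]
  simp [potentialDensity, lap_zero]

lemma JCN_one (N : S2 → Fin 3 → ℝ) (χ : S2 → Fin 3 → Fin 3 → ℝ) (n : S2 → ℝ) :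
    JCN 1 N χ n = JCJK N χ n := by
  simp [JCN]

lemma JCN_eq (hN : Integrable (fun p => ∑ i, N p i * rot n p i) area)
    (hquad : Integrable (fun p => ∑ i, quad χ p i * rot n p i) area) :
    JCN α N χ n = 1 / (8 * Real.pi) * (-3 * ∫ p, ∑ i, N p i * rot n p i ∂area
      - α / 4 * ∫ p, ∑ i, quad χ p i * rot n p i ∂area) := by
  have hsum : ∫ p, ∑ i, (3 * N p i + 1 / 4 * quad χ p i) * rot n p i ∂area
      = 3 * ∫ p, ∑ i, N p i * rot n p i ∂area
        + 1 / 4 * ∫ p, ∑ i, quad χ p i * rot n p i ∂area := by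
    rw [← integral_const_mul, ← integral_const_mul,
      ← integral_add (hN.const_mul 3) (hquad.const_mul (1 / 4))]
    simp only [add_mul, Finset.sum_add_distrib, Finset.mul_sum, mul_assoc]
  have hπ := Real.pi_ne_zero
  simp only [JCN, JCJK, hsum, mul_comm (rot n _ _)]
  field_simp
  ring

lemma integrable_quad_shearOf (hn : Smooth n) (hb : Smooth b) (hc : Smooth c) :
    Integrable (fun p => ∑ i, quad (shearOf b c) p i * rot n p i) area := by
  obtain ⟨n, rfl⟩ := hn.exists_eq_coe
  obtain ⟨b, rfl⟩ := hb.exists_eq_coe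
  obtain ⟨c, rfl⟩ := hc.exists_eq_coe
  simp only [shearOf_coe, sum_quad_mul_rot (sphereCalculus.isSTT_shearPair b c)]
  exact SmoothFn.integrable _

/-- The density of the angular momentum with parameter `α`, in terms of the potentials. -/
def angularDensity (α : ℝ) (N : S2 → Fin 3 → ℝ) (n b c : S2 → ℝ) (p : S2) : ℝ :=
  -3 * (∑ i, N p i * rot n p i) - 2 * α * gradDot n c p * lap b p
    + α / 2 * n p * lap b p * lap c p - α / 2 * lap b p * gradDot n (lap c) p

lemma angularDensity_eq (α : ℝ) (N : S2 → Fin 3 → ℝ) (n b c : S2 → ℝ) :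
    angularDensity α N n b c
      = fun p => -3 * (∑ i, N p i * rot n p i) + α / 2 * potentialDensity n b c p := by
  funext p
  rw [angularDensity, potentialDensity]
  ring

lemma integrable_angularDensity (hN : ∀ i, Smooth fun p => N p i) (hn : Smooth n)
    (hb : Smooth b) (hc : Smooth c) : Integrable (angularDensity α N n b c) area := by
  rw [angularDensity_eq]
  exact ((integrable_sum_mul_rot hN hn).const_mul _).add
    ((integrable_potentialDensity hn hb hc).const_mul _)

lemma JCN_shearOf (hN : ∀ i, Smooth fun p => N p i) (hn : IsDipole n) (hb : Smooth b)
    (hc : Smooth c) :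
    JCN α N (shearOf b c) n = 1 / (8 * Real.pi) * ∫ p, angularDensity α N n b c p ∂area := by
  have hint := integrable_sum_mul_rot hN hn.smooth
  rw [JCN_eq hint (integrable_quad_shearOf hn.smooth hb hc), integral_quad_shearOf hn hb hc,
    angularDensity_eq, integral_add (hint.const_mul _)
      ((integrable_potentialDensity hn.smooth hb hc).const_mul _),
    integral_const_mul, integral_const_mul]
  ring

lemma JCJK_shearOf (hN : ∀ i, Smooth fun p => N p i) (hn : IsDipole n) (hb : Smooth b)
    (hc : Smooth c) :
    JCJK N (shearOf b c) n = 1 / (8 * Real.pi) * ∫ p, angularDensity 1 N n b c p ∂area := by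
  rw [← JCN_one, JCN_shearOf hN hn hb hc]

lemma integrable_mul_sum_rot_mul_grad (hm : Smooth m) (hn : Smooth n) (hc : Smooth c) :
    Integrable (fun p => m p * ∑ i, rot n p i * grad c p i) area := by
  have h := integrable_sum_mul_rot (w := fun p i => m p * grad c p i)
    (fun i => hm.mul (hc.tder i)) hn
  simpa only [Finset.mul_sum, mul_assoc, mul_comm (rot n _ _)] using h

lemma JCWY_shearOf (hm : Smooth m) (hN : ∀ i, Smooth fun p => N p i) (hn : IsDipole n)
    (hb : Smooth b) (hc : Smooth c) (hlow : NoLowModes c) :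
    JCWY m N (shearOf b c) n = 1 / (8 * Real.pi) * ∫ p,
      (angularDensity 1 N n b c p + 2 * m p * ∑ i, rot n p i * grad c p i) ∂area := by
  have hmass : Integrable (fun p => 2 * (m p * ∑ i, rot n p i * grad c p i)) area :=
    (integrable_mul_sum_rot_mul_grad hm hn.smooth hc).const_mul 2
  have hπ := Real.pi_ne_zero
  simp only [mul_assoc (2 : ℝ) (m _)]
  rw [JCWY, cwyPotential_shearOf hb hc hlow, JCJK_shearOf hN hn hb hc,
    integral_add (integrable_angularDensity hN hn.smooth hb hc) hmass, integral_const_mul]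
  field_simp
  ring

end AngularMomenta

end NullInfinity

end

theorem mainTheorem9
    (χ : NullInfinity.S2 → Fin 3 → Fin 3 → ℝ) (hχ : NullInfinity.IsSymmTraceless χ)
    (N : NullInfinity.S2 → Fin 3 → ℝ) (hN : NullInfinity.IsOneForm N)
    (m : NullInfinity.S2 → ℝ) (hm : NullInfinity.Smooth m)
    (n : NullInfinity.S2 → ℝ) (hn : NullInfinity.IsDipole n) (α : ℝ) :
    (∃ b c : NullInfinity.S2 → ℝ,
      NullInfinity.Smooth b ∧ NullInfinity.Smooth c ∧
      NullInfinity.NoLowModes b ∧ NullInfinity.NoLowModes c ∧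
      χ = NullInfinity.shearOf b c) ∧
    (∃! c : NullInfinity.S2 → ℝ, NullInfinity.IsCWYPotential χ c) ∧
    (∀ b c : NullInfinity.S2 → ℝ, NullInfinity.Smooth b → NullInfinity.Smooth c →
      χ = NullInfinity.shearOf b c →
      (∫ p, ∑ i, NullInfinity.quad (NullInfinity.shearOf b 0) p i * NullInfinity.rot n p i
          ∂NullInfinity.area = 0) ∧
      (∫ p, ∑ i, NullInfinity.quad (NullInfinity.shearOf 0 c) p i * NullInfinity.rot n p i
          ∂NullInfinity.area = 0) ∧
      NullInfinity.JCJK N χ n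
        = 1 / (8 * Real.pi) * ∫ p,
            (-3 * (∑ i, N p i * NullInfinity.rot n p i)
              - 2 * NullInfinity.gradDot n c p * NullInfinity.lap b p
              + 1 / 2 * n p * NullInfinity.lap b p * NullInfinity.lap c p
              - 1 / 2 * NullInfinity.lap b p
                  * NullInfinity.gradDot n (NullInfinity.lap c) p) ∂NullInfinity.area ∧
      NullInfinity.JCN α N χ n
        = 1 / (8 * Real.pi) * ∫ p,
            (-3 * (∑ i, N p i * NullInfinity.rot n p i)
              - 2 * α * NullInfinity.gradDot n c p * NullInfinity.lap b p
              + α / 2 * n p * NullInfinity.lap b p * NullInfinity.lap c p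
              - α / 2 * NullInfinity.lap b p
                  * NullInfinity.gradDot n (NullInfinity.lap c) p) ∂NullInfinity.area ∧
      (NullInfinity.NoLowModes c →
        NullInfinity.IsCWYPotential χ c ∧
        NullInfinity.JCWY m N χ n
          = 1 / (8 * Real.pi) * ∫ p,
              (-3 * (∑ i, N p i * NullInfinity.rot n p i)
                - 2 * NullInfinity.gradDot n c p * NullInfinity.lap b p
                + 1 / 2 * n p * NullInfinity.lap b p * NullInfinity.lap c p
                - 1 / 2 * NullInfinity.lap b p
                    * NullInfinity.gradDot n (NullInfinity.lap c) p
                + 2 * m p * ∑ i, NullInfinity.rot n p i * NullInfinity.grad c p i)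
              ∂NullInfinity.area)) := by
  open NullInfinity in
  refine ⟨exists_eq_shearOf hχ, existsUnique_isCWYPotential hχ, ?_⟩
  rintro b c hb hc rfl
  refine ⟨integral_quad_shearOf_zero_right hn hb, integral_quad_shearOf_zero_left hn hc, ?_,
    JCN_shearOf hN.smooth hn hb hc, fun hlow => ⟨isCWYPotential_shearOf hb hc hlow, ?_⟩⟩
  · simpa only [angularDensity, mul_one] using JCJK_shearOf hN.smooth hn hb hc
  · simpa only [angularDensity, mul_one] using JCWY_shearOf hm hN.smooth hn hb hc hlow
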